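/- Let $\Gamma$ be the fundamental group of a closed orientable surface of genus at least $2$, let $\iota:\Gamma\to H=\mathrm{SL}(2,\mathbb R)$ be an injective morphism with discrete image, and let $\Phi^t$ be the flow on $M=\iota(\Gamma)\backslash H$ induced by right multiplication by $a^t=\mathrm{diag}(e^t,e^{-t})$. Let $V=\mathbb R^3$ and $G=\mathrm{SL}(V)\cong\mathrm{PGL}(3,\mathbb R)$. Let $X\subset P(V)\times P(V^*)$ be the flag variety, i.e. the set of pairs $([u],[u^*])$ with $\langle u\mid u^*\rangle=0$, and let $Y$ be the frame variety, i.e. the set of triples $([u],[v],[w])$ of noncollinear points of $P(V)$. Write $[(uv)^*]\in P(V^*)$ for the projective line through $[u]\ne[v]$, and set $\pi_+([u],[v],[w])=([u],[(uv)^*])$ and $\pi_-([u],[v],[w])=([w],[(wv)^*])$; let $E^\pm\subset TY$ be the tangent bundle to the fibres of $\pi_\pm:Y\to X$. For a representation $\rho:\Gamma\to G$ let $E_\rho\to M$ be the flat bundle $\Gamma\backslash(H\times Y)$, where $\gamma(h,y)=(\iota(\gamma)h,\rho(\gamma)y)$, with the horizontal flow $\Phi^t_\rho$ induced by $(h,y)\mapsto(ha^t,y)$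 and the vertical subbundles $E^\pm_\rho$ induced by $E^\pm$. The representation $\rho$ is $(G,Y)$-Anosov if $E_\rho\to M$ has a continuous section $s$ whose image $S$ is $\Phi^t_\rho$-invariant and such that, for every continuous norm $\Vert\cdot\Vert$ on the vertical tangent bundle of $E_\rho$, there are constants $a,b>0$ with $$\Vert D_p\Phi^t_\rho(v^+)\Vert\le be^{-at}\Vert v^+\Vert,\qquad \Vert D_p\Phi^{-t}_\rho(v^-)\Vert\le be^{-at}\Vert v^-\Vert$$ for all $p\in S$, all $t>0$ and all vectors $v^\pm\in E^\pm_\rho$ over $p$. The section $s$ lifts to a continuous $\Gamma$-equivariant map $f:H\to Y$ with $f(ha^t)=f(h)$. Let $\Lambda=\pi_+(f(H))\subset X$ be the limit curve, let $L\subset P(V)$ and $L^*\subset P(V^*)$ be its two projections, and let $\Omega$ be the set of flags $([u],[u^*])\in X$ with $[u]\notin L$ and $[u^*]\notin L^*$. **Theorem.** For every $(G,Y)$-Anosov representation $\rho:\Gamma\to G$ (and every section $s$ as above), $\Omega$ is open and $\rho(\Gamma)$-invariant, and the action of $\Gamma$ on $\Omega$ through $\rho$ is free (if $\rho(\gamma)x=x$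 for some $x\in\Omega$, then $\gamma=1$) and properly discontinuous (for all compact $K,K'\subset\Omega$, the set of $\gamma\in\Gamma$ with $\rho(\gamma)K\cap K'\ne\emptyset$ is finite). -/

import Mathlib

open scoped LinearAlgebra.Projectivization MatrixGroups

noncomputable section

namespace AnosovFlag

/-! ### Surface groups -/

/-- The relator `[a₁, b₁] ⋯ [a_g, b_g]` in the free group on `a₁, …, a_g, b₁, …, b_g`
(`Sum.inl` indexes the `aⱼ`, `Sum.inr` the `bⱼ`). -/
def surfaceRelator (g : ℕ) : FreeGroup (Fin g ⊕ Fin g) :=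
  (List.ofFn fun j : Fin g =>
    FreeGroup.of (Sum.inl j) * FreeGroup.of (Sum.inr j) *
      (FreeGroup.of (Sum.inl j))⁻¹ * (FreeGroup.of (Sum.inr j))⁻¹).prod

/-- The fundamental group of the closed orientable surface of genus `g`. -/
abbrev SurfaceGroup (g : ℕ) : Type := PresentedGroup {surfaceRelator g}

/-- `Γ` is the fundamental group of a closed orientable surface of negative Euler
characteristic, i.e. of genus at least two. -/
def IsHyperbolicSurfaceGroup (Γ : Type*) [Group Γ] : Prop :=
  ∃ g : ℕ, 2 ≤ g ∧ Nonempty (Γ ≃* SurfaceGroup g)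

/-! ### The flag variety -/

/-- The projective plane `P(V)`, `V = ℝ³`. The dual plane `P(V*)` is also written `P2`, in the
coordinates of the dual basis: the pairing of `V` with `V*` is then the dot product. -/
abbrev P2 : Type := ℙ ℝ (Fin 3 → ℝ)

/-- The quotient topology of the projective plane. -/
instance instTopologicalSpaceP2 : TopologicalSpace P2 :=
  TopologicalSpace.coinduced (Projectivization.mk' ℝ) inferInstance

/-- The dual action on `V*`: in coordinates, `g*` is the inverse of the transpose of `g`. -/
def dual (g : SL(3, ℝ)) : SL(3, ℝ) := (g⁻¹).transpose

theorem dual_one : dual 1 = 1 := by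
  apply Subtype.ext
  change ((1 : SL(3, ℝ))⁻¹).1.transpose = 1
  simp

theorem dual_mul (g h : SL(3, ℝ)) : dual (g * h) = dual g * dual h := by
  apply Subtype.ext
  change ((g * h)⁻¹).1.transpose = (g⁻¹).1.transpose * (h⁻¹).1.transpose
  rw [mul_inv_rev, ← Matrix.transpose_mul]
  rfl

theorem orthogonal_smul (g : SL(3, ℝ)) (p q : P2) (h : p.orthogonal q) :
    (g • p).orthogonal (dual g • q) := by
  induction p using Projectivization.ind with | _ v hv =>
  induction q using Projectivization.ind with | _ w hw =>
  rw [Projectivization.orthogonal_mk hv hw] at h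
  rw [Projectivization.smul_mk, Projectivization.smul_mk, Projectivization.orthogonal_mk]
  change (g.1.mulVec v) ⬝ᵥ ((g⁻¹).1.transpose.mulVec w) = 0
  have hg : (g⁻¹).1 * g.1 = 1 := congrArg Subtype.val (inv_mul_cancel g)
  rw [Matrix.mulVec_transpose, dotProduct_comm, ← Matrix.dotProduct_mulVec, Matrix.mulVec_mulVec,
    hg, Matrix.one_mulVec, dotProduct_comm, h]

/-- The flag variety `X`: pairs `([u], [u*])` in `P(V) × P(V*)` with `⟨u | u*⟩ = 0`. -/
def Flag : Type := {F : P2 × P2 // F.1.orthogonal F.2}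

instance : TopologicalSpace Flag := instTopologicalSpaceSubtype

/-- The point `[u]` of a flag `([u], [u*])`. -/
def Flag.pt (F : Flag) : P2 := F.1.1

/-- The line `[u*]` of a flag `([u], [u*])`. -/
def Flag.line (F : Flag) : P2 := F.1.2

instance : MulAction SL(3, ℝ) Flag where
  smul g F := ⟨(g • F.1.1, dual g • F.1.2), orthogonal_smul g _ _ F.2⟩
  one_smul F := Subtype.ext <| Prod.ext (one_smul _ F.1.1) <| by
    change dual 1 • F.1.2 = F.1.2
    rw [dual_one, one_smul]
  mul_smul g h F := Subtype.ext <| Prod.ext (mul_smul g h F.1.1) <| by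
    change dual (g * h) • F.1.2 = dual g • dual h • F.1.2
    rw [dual_mul, mul_smul]

/-! ### The frame variety -/

theorem independent_smul (g : SL(3, ℝ)) (p : Fin 3 → P2) (h : Projectivization.Independent p) :
    Projectivization.Independent (fun j => g • p j) := by
  cases h with | mk f hf hl =>
  have hinj : LinearMap.ker (DistribSMul.toLinearMap ℝ (Fin 3 → ℝ) g) = ⊥ :=
    LinearMap.ker_eq_bot.2 (MulAction.injective g)
  exact Projectivization.Independent.mk (fun j => g • f j)
    (fun j => (smul_ne_zero_iff_ne g).2 (hf j)) (hl.map' _ hinj)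

/-- The frame variety `Y`: triples `([u], [v], [w])` of noncollinear points of `P(V)`
(`u`, `v`, `w` have the indices `0`, `1`, `2`). -/
def Frame : Type := {y : Fin 3 → P2 // Projectivization.Independent y}

instance : TopologicalSpace Frame := instTopologicalSpaceSubtype

instance : MulAction SL(3, ℝ) Frame where
  smul g y := ⟨fun j => g • y.1 j, independent_smul g _ y.2⟩
  one_smul y := Subtype.ext <| funext fun j => one_smul _ (y.1 j)
  mul_smul g h y := Subtype.ext <| funext fun j => mul_smul g h (y.1 j)

theorem Frame.injective (y : Frame) : Function.Injective y.1 := by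
  intro j k hjk
  exact (Projectivization.independent_iff.1 y.2).injective (congrArg Projectivization.rep hjk)

open Classical in
/-- The flag `([u], [(uv)*])` of two distinct points; in coordinates `(uv)*` is spanned by the
cross product of `u` and `v`. -/
def flagOf (p q : P2) (h : p ≠ q) : Flag :=
  ⟨(p, p.cross q), Projectivization.orthogonal_cross_left h⟩

/-- The projection `π₊ ([u], [v], [w]) = ([u], [(uv)*])`. -/
def piPlus (y : Frame) : Flag := flagOf (y.1 0) (y.1 1) (y.injective.ne (by decide))

/-- The projection `π₋ ([u], [v], [w]) = ([w], [(wv)*])`. -/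
def piMinus (y : Frame) : Flag := flagOf (y.1 2) (y.1 1) (y.injective.ne (by decide))

/-! ### Tangent vectors of the frame variety

`Y` is a homogeneous space of `GL(V)`, so the map sending `A ∈ gl(V)` to the velocity at `s = 0` of
`s ↦ exp(sA) y` identifies `T_y Y` with the quotient of `gl(V)` by the stabilizer subalgebra of `y`.
Tangent vectors at `y` are given by matrices `A` through this identification; `A` represents `0`
if and only if it preserves the three lines of the frame. The differential of `y ↦ g y` is
represented by `A ↦ g A g⁻¹`. -/

/-- `gl(V)`. -/
abbrev Mat3 : Type := Matrix (Fin 3) (Fin 3) ℝ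

/-- The matrix `A` maps the line `p` of `ℝ³` into itself. -/
def PreservesLine (A : Mat3) (p : P2) : Prop := ∀ v ∈ p.submodule, A.mulVec v ∈ p.submodule

/-- `A` belongs to the stabilizer subalgebra of the frame `y`. -/
def FixesFrame (A : Mat3) (y : Frame) : Prop := ∀ j, PreservesLine A (y.1 j)

/-- `A` belongs to the stabilizer subalgebra of the flag `F` (its infinitesimal action on `V*` is
`-Aᵀ`). For `F = π₊ y`, this says that the tangent vector at `y` represented by `A` is tangent to
the fibre of `π₊`, that is, lies in `E⁺`; likewise for `π₋` and `E⁻`. -/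
def FixesFlag (A : Mat3) (F : Flag) : Prop :=
  PreservesLine A F.pt ∧ PreservesLine A.transpose F.line

/-! ### Anosov structures -/

/-- The one-parameter subgroup `aᵗ = diag(eᵗ, e⁻ᵗ)` of `SL(2, ℝ)`. -/
def diagFlow (t : ℝ) : SL(2, ℝ) :=
  ⟨!![Real.exp t, 0; 0, Real.exp (-t)], by
    rw [Matrix.det_fin_two_of, ← Real.exp_add]; simp⟩

variable {Γ : Type*} [Group Γ]

/-- A continuous norm on the vertical tangent bundle of the flat bundle `E_ρ = Γ \ (H × Y)` over
`M = ι(Γ) \ H`, `H = SL(2, ℝ)`, with `γ (h, y) = (ι(γ) h, ρ(γ) y)`: a `Γ`-invariant family of norms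
on the spaces `T_y Y`, depending continuously on `(h, y)`. A norm on `T_y Y` is a seminorm on
`gl(V)` whose null space is the stabilizer subalgebra of `y`. -/
structure VerticalNorm (ι : Γ →* SL(2, ℝ)) (ρ : Γ →* SL(3, ℝ)) where
  /-- The norm over the point `(h, y)`. -/
  norm : SL(2, ℝ) → Frame → Seminorm ℝ Mat3
  norm_eq_zero_iff : ∀ h y A, norm h y A = 0 ↔ FixesFrame A y
  continuous_norm : Continuous fun q : SL(2, ℝ) × Frame × Mat3 => norm q.1 q.2.1 q.2.2
  norm_smul : ∀ (γ : Γ) h y (A : Mat3),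
    norm (ι γ * h) (ρ γ • y) ((ρ γ : Mat3) * A * ((ρ γ)⁻¹ : SL(3, ℝ))) = norm h y A

/-- A `(G, Y)`-Anosov structure over `(M, Φᵗ)`, where `Φᵗ` is induced by `h ↦ h aᵗ`. The section `s`
of `E_ρ → M` is given by its lift `f : H → Y`, and the horizontal flow is `(h, y) ↦ (h aᵗ, y)`. -/
structure IsAnosovStructure (ι : Γ →* SL(2, ℝ)) (ρ : Γ →* SL(3, ℝ)) (f : SL(2, ℝ) → Frame) :
    Prop where
  continuous : Continuous f
  equivariant : ∀ (γ : Γ) h, f (ι γ * h) = ρ γ • f h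
  flow_invariant : ∀ h t, f (h * diagFlow t) = f h
  hyperbolic : ∀ N : VerticalNorm ι ρ, ∃ a b : ℝ, 0 < a ∧ 0 < b ∧
    ∀ (h : SL(2, ℝ)) (t : ℝ), 0 < t → ∀ A : Mat3,
      (FixesFlag A (piPlus (f h)) →
        N.norm (h * diagFlow t) (f h) A ≤ b * Real.exp (-a * t) * N.norm h (f h) A) ∧
      (FixesFlag A (piMinus (f h)) →
        N.norm (h * diagFlow (-t)) (f h) A ≤ b * Real.exp (-a * t) * N.norm h (f h) A)

/-! ### The limit curves and the domain `Ω` -/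

/-- The limit curve `Λ ⊆ X`, the image of `π₊ ∘ f`. -/
def limitCurve (f : SL(2, ℝ) → Frame) : Set Flag := Set.range fun h => piPlus (f h)

/-- The curve `L ⊆ P(V)`. -/
def curveL (f : SL(2, ℝ) → Frame) : Set P2 := Flag.pt '' limitCurve f

/-- The curve `L* ⊆ P(V*)`. -/
def curveLDual (f : SL(2, ℝ) → Frame) : Set P2 := Flag.line '' limitCurve f

/-- The set `Ω` of flags `([u], [u*])` with `[u] ∉ L` and `[u*] ∉ L*`. -/
def domainOmega (f : SL(2, ℝ) → Frame) : Set Flag :=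
  {F | F.pt ∉ curveL f ∧ F.line ∉ curveLDual f}

end AnosovFlag

end

namespace AnosovFlag

/-! ### Surface groups are torsion-free -/

section TorsionFree

variable {n : ℕ}

/-- Free generators of the kernel of the map from a surface group of genus `n + 1` to `ℤ` that
sends `a₁` to `1` and the other generators to `0`. -/
abbrev CyclicCoverGen (n : ℕ) : Type := Option ((Fin n ⊕ Fin n) × ℤ)

/-- The product of the commutators of the generators in level `k` of the cyclic cover. -/
def levelRelator (n : ℕ) (k : ℤ) : FreeGroup (CyclicCoverGen n) :=
  (List.ofFn fun j : Fin n =>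
    FreeGroup.of (some (Sum.inl j, k)) * FreeGroup.of (some (Sum.inr j, k)) *
      (FreeGroup.of (some (Sum.inl j, k)))⁻¹ * (FreeGroup.of (some (Sum.inr j, k)))⁻¹).prod

/-- The deck transformation of the cyclic cover. -/
def deckHom (n : ℕ) : FreeGroup (CyclicCoverGen n) →* FreeGroup (CyclicCoverGen n) :=
  FreeGroup.lift fun
    | none => (levelRelator n 0)⁻¹ * FreeGroup.of none
    | some (x, k) => FreeGroup.of (some (x, k + 1))

/-- The inverse of the deck transformation of the cyclic cover. -/
def deckInvHom (n : ℕ) : FreeGroup (CyclicCoverGen n) →* FreeGroup (CyclicCoverGen n) :=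
  FreeGroup.lift fun
    | none => levelRelator n (-1) * FreeGroup.of none
    | some (x, k) => FreeGroup.of (some (x, k - 1))

theorem deckHom_levelRelator (k : ℤ) :
    deckHom n (levelRelator n k) = levelRelator n (k + 1) := by
  simp [levelRelator, map_list_prod, List.map_ofFn, Function.comp_def, deckHom]

theorem deckInvHom_levelRelator (k : ℤ) :
    deckInvHom n (levelRelator n k) = levelRelator n (k - 1) := by
  simp [levelRelator, map_list_prod, List.map_ofFn, Function.comp_def, deckInvHom]

theorem deckHom_none :
    deckHom n (FreeGroup.of none) = (levelRelator n 0)⁻¹ * FreeGroup.of none := by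
  simp [deckHom]

theorem deckInvHom_none :
    deckInvHom n (FreeGroup.of none) = levelRelator n (-1) * FreeGroup.of none := by
  simp [deckInvHom]

/-- The deck transformation as an automorphism. -/
def deckAut (n : ℕ) : MulAut (FreeGroup (CyclicCoverGen n)) :=
  MonoidHom.toMulEquiv (deckHom n) (deckInvHom n)
    (by
      ext x
      rcases x with _ | ⟨x, k⟩
      · simp [deckHom_none, deckInvHom_none, deckInvHom_levelRelator]
      · simp [deckHom, deckInvHom])
    (by
      ext x
      rcases x with _ | ⟨x, k⟩
      · simp [deckHom_none, deckInvHom_none, deckHom_levelRelator]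
      · simp [deckHom, deckInvHom])

theorem deckAut_apply (x : FreeGroup (CyclicCoverGen n)) : deckAut n x = deckHom n x := rfl

/-- The semidirect product of the group of the cyclic cover with its deck group. -/
abbrev CoverExtension (n : ℕ) : Type :=
  FreeGroup (CyclicCoverGen n) ⋊[zpowersHom _ (deckAut n)] Multiplicative ℤ

/-- The generators of the surface group in `CoverExtension n`. -/
def coverGen (n : ℕ) : Fin (n + 1) ⊕ Fin (n + 1) → CoverExtension n
  | Sum.inl j => Fin.cases (SemidirectProduct.inr (Multiplicative.ofAdd 1))
      (fun i => SemidirectProduct.inl (FreeGroup.of (some (Sum.inl i, 0)))) j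
  | Sum.inr j => Fin.cases (SemidirectProduct.inl (FreeGroup.of none))
      (fun i => SemidirectProduct.inl (FreeGroup.of (some (Sum.inr i, 0)))) j

theorem lift_coverGen_surfaceRelator :
    FreeGroup.lift (coverGen n) (surfaceRelator (n + 1)) = 1 := by
  have h1 : (SemidirectProduct.inr (Multiplicative.ofAdd 1) : CoverExtension n) *
      SemidirectProduct.inl (FreeGroup.of none) *
      (SemidirectProduct.inr (Multiplicative.ofAdd 1))⁻¹ =
      SemidirectProduct.inl ((levelRelator n 0)⁻¹ * FreeGroup.of none) := by
    rw [← deckHom_none, ← deckAut_apply, ← map_inv, ← SemidirectProduct.inl_aut]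
    simp
  have h2 : (List.ofFn fun j : Fin n =>
      (SemidirectProduct.inl (FreeGroup.of (some (Sum.inl j, 0))) : CoverExtension n) *
      SemidirectProduct.inl (FreeGroup.of (some (Sum.inr j, 0))) *
      (SemidirectProduct.inl (FreeGroup.of (some (Sum.inl j, 0))))⁻¹ *
      (SemidirectProduct.inl (FreeGroup.of (some (Sum.inr j, 0))))⁻¹).prod =
      SemidirectProduct.inl (levelRelator n 0) := by
    simp [levelRelator, map_list_prod, List.map_ofFn, Function.comp_def]
  rw [surfaceRelator, List.ofFn_succ, List.prod_cons, map_mul, map_list_prod, List.map_ofFn]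
  simp only [map_mul, map_inv, FreeGroup.lift_apply_of, coverGen, Function.comp_def, Fin.cases_zero,
    Fin.cases_succ]
  rw [h1, h2, ← map_inv, ← map_mul, ← map_mul]
  simp

/-- The homomorphism from the surface group to `CoverExtension n`. -/
def toCoverExtension (n : ℕ) : SurfaceGroup (n + 1) →* CoverExtension n :=
  PresentedGroup.toGroup (f := coverGen n) (by
    rintro r rfl
    exact lift_coverGen_surfaceRelator)

/-- The generators of the cyclic cover in the surface group. -/
def ofCoverGen (n : ℕ) : CyclicCoverGen n → SurfaceGroup (n + 1)
  | none => PresentedGroup.of (Sum.inr 0)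
  | some (x, k) => PresentedGroup.of (Sum.inl 0) ^ k *
      PresentedGroup.of (Sum.map Fin.succ Fin.succ x) * (PresentedGroup.of (Sum.inl 0) ^ k)⁻¹

theorem commutator_mul_levelRelator :
    (PresentedGroup.of (Sum.inl 0) * PresentedGroup.of (Sum.inr 0) *
      (PresentedGroup.of (Sum.inl 0))⁻¹ * (PresentedGroup.of (Sum.inr 0))⁻¹ *
      FreeGroup.lift (ofCoverGen n) (levelRelator n 0) : SurfaceGroup (n + 1)) = 1 := by
  have hrel : ∀ r : FreeGroup (Fin (n + 1) ⊕ Fin (n + 1)), r = surfaceRelator (n + 1) →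
      (PresentedGroup.mk {surfaceRelator (n + 1)}) r = 1 := by
    rintro r rfl
    exact PresentedGroup.one_of_mem rfl
  have h := hrel _ (by rw [surfaceRelator, List.ofFn_succ, List.prod_cons])
  rw [← h]
  simp [levelRelator, map_list_prod, List.map_ofFn, Function.comp_def, ofCoverGen,
    PresentedGroup.of]

theorem lift_ofCoverGen_deckHom (x : FreeGroup (CyclicCoverGen n)) :
    FreeGroup.lift (ofCoverGen n) (deckHom n x) = PresentedGroup.of (Sum.inl 0) *
      FreeGroup.lift (ofCoverGen n) x * (PresentedGroup.of (Sum.inl 0))⁻¹ := by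
  suffices h : (FreeGroup.lift (ofCoverGen n)).comp (deckHom n) =
      (MulAut.conj (PresentedGroup.of (Sum.inl 0))).toMonoidHom.comp
        (FreeGroup.lift (ofCoverGen n)) by
    simpa using DFunLike.congr_fun h x
  ext x
  rcases x with _ | ⟨x, k⟩
  · simp only [MonoidHom.comp_apply, deckHom_none, map_mul, map_inv, FreeGroup.lift_apply_of]
    rw [← mul_eq_one_iff_eq_inv.1 commutator_mul_levelRelator]
    simp [ofCoverGen]
  · simp only [MonoidHom.comp_apply, deckHom, FreeGroup.lift_apply_of, ofCoverGen,
      MulEquiv.toMonoidHom_eq_coe, MonoidHom.coe_coe, MulAut.conj_apply]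
    group

theorem lift_ofCoverGen_deckAut_zpow (k : ℤ) (x : FreeGroup (CyclicCoverGen n)) :
    FreeGroup.lift (ofCoverGen n) ((deckAut n ^ k) x) = PresentedGroup.of (Sum.inl 0) ^ k *
      FreeGroup.lift (ofCoverGen n) x * (PresentedGroup.of (Sum.inl 0) ^ k)⁻¹ := by
  induction k generalizing x with
  | zero => simp
  | succ k ih =>
    rw [zpow_add_one, MulAut.mul_apply, ih, deckAut_apply, lift_ofCoverGen_deckHom]
    group
  | pred k ih =>
    obtain ⟨z, rfl⟩ := (deckAut n).surjective x
    rw [zpow_sub_one, MulAut.mul_apply, MulAut.inv_apply_self, ih, deckAut_apply,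
      lift_ofCoverGen_deckHom]
    group

/-- The homomorphism from `CoverExtension n` to the surface group. -/
def ofCoverExtension (n : ℕ) : CoverExtension n →* SurfaceGroup (n + 1) :=
  SemidirectProduct.lift (FreeGroup.lift (ofCoverGen n))
    (zpowersHom _ (PresentedGroup.of (Sum.inl 0))) (by
      intro g
      apply MonoidHom.ext
      intro x
      simp only [MonoidHom.comp_apply, zpowersHom_apply, MulEquiv.toMonoidHom_eq_coe,
        MonoidHom.coe_coe, MulAut.conj_apply]
      exact lift_ofCoverGen_deckAut_zpow _ x)

theorem toCoverExtension_injective : Function.Injective (toCoverExtension n) := by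
  have h : (ofCoverExtension n).comp (toCoverExtension n) = MonoidHom.id _ := by
    ext x
    rcases x with j | j <;> refine Fin.cases ?_ (fun i => ?_) j <;>
      simp [toCoverExtension, coverGen, ofCoverExtension, ofCoverGen]
  exact Function.LeftInverse.injective (g := ofCoverExtension n) (DFunLike.congr_fun h)

theorem CoverExtension.eq_one_of_pow_eq_one (x : CoverExtension n) {k : ℕ} (hk : k ≠ 0)
    (h : x ^ k = 1) : x = 1 := by
  have hr : x.right = 1 := by
    have h1 := congrArg SemidirectProduct.rightHom h
    rw [map_pow, map_one] at h1
    exact (pow_eq_one_iff_left hk).1 h1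
  have hx : x = SemidirectProduct.inl x.left := by
    rw [← SemidirectProduct.inl_left_mul_inr_right x, hr]
    simp
  rw [hx, ← map_pow, ← map_one SemidirectProduct.inl] at h
  have := (pow_eq_one_iff_left hk).1 (SemidirectProduct.inl_injective h)
  rw [hx, this, map_one]

/-- A hyperbolic surface group has no torsion. -/
theorem IsHyperbolicSurfaceGroup.eq_one_of_pow_eq_one {Γ : Type*} [Group Γ]
    (hΓ : IsHyperbolicSurfaceGroup Γ) (γ : Γ) {k : ℕ} (hk : k ≠ 0) (h : γ ^ k = 1) : γ = 1 := by
  obtain ⟨g, hg, ⟨e⟩⟩ := hΓ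
  obtain ⟨n, rfl⟩ : ∃ n, g = n + 1 := ⟨g - 1, by omega⟩
  apply e.injective
  apply toCoverExtension_injective
  rw [map_one, map_one]
  apply CoverExtension.eq_one_of_pow_eq_one _ hk
  rw [← map_pow, ← map_pow, h, map_one, map_one]

end TorsionFree

end AnosovFlag

namespace AnosovFlag

/-! ### Homogeneous coordinates -/

open Filter Topology
open scoped Matrix

/-- The nonzero vector `u` spans the point `p` of the projective plane. -/
def Rep (u : Fin 3 → ℝ) (p : P2) : Prop := ∃ hu : u ≠ 0, Projectivization.mk ℝ u hu = p

theorem rep_mk {u : Fin 3 → ℝ} (hu : u ≠ 0) : Rep u (Projectivization.mk ℝ u hu) := ⟨hu, rfl⟩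

theorem rep_rep (p : P2) : Rep p.rep p := ⟨p.rep_nonzero, p.mk_rep⟩

theorem Rep.eq_smul {u v : Fin 3 → ℝ} {p : P2} (hu : Rep u p) (hv : Rep v p) :
    ∃ d : ℝ, d ≠ 0 ∧ v = d • u := by
  obtain ⟨hu, rfl⟩ := hu
  obtain ⟨hv, h⟩ := hv
  obtain ⟨d, hd⟩ := (Projectivization.mk_eq_mk_iff ℝ v u hv hu).1 h
  exact ⟨d, d.ne_zero, hd.symm⟩

theorem Rep.smul {u : Fin 3 → ℝ} {p : P2} (hu : Rep u p) {d : ℝ} (hd : d ≠ 0) :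
    Rep (d • u) p := by
  obtain ⟨hu, rfl⟩ := hu
  exact ⟨smul_ne_zero hd hu, (Projectivization.mk_eq_mk_iff' ℝ _ _ _ _).2 ⟨d, rfl⟩⟩

theorem Rep.unique {u : Fin 3 → ℝ} {p q : P2} (hp : Rep u p) (hq : Rep u q) : p = q := by
  obtain ⟨hu, rfl⟩ := hp
  obtain ⟨_, rfl⟩ := hq
  rfl

theorem Rep.mulVec {u : Fin 3 → ℝ} {p : P2} (hu : Rep u p) (g : SL(3, ℝ)) :
    Rep (g.1 *ᵥ u) (g • p) := by
  obtain ⟨hu, rfl⟩ := hu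
  rw [Projectivization.smul_mk]
  exact rep_mk _

theorem Rep.orthogonal_iff {u v : Fin 3 → ℝ} {p q : P2} (hu : Rep u p) (hv : Rep v q) :
    p.orthogonal q ↔ u ⬝ᵥ v = 0 := by
  obtain ⟨hu, rfl⟩ := hu
  obtain ⟨hv, rfl⟩ := hv
  exact Projectivization.orthogonal_mk hu hv

open Classical in
theorem Rep.cross {u v : Fin 3 → ℝ} {p q : P2} (hu : Rep u p) (hv : Rep v q) (hpq : p ≠ q) :
    Rep (u ⨯₃ v) (p.cross q) := by
  obtain ⟨hu, rfl⟩ := hu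
  obtain ⟨hv, rfl⟩ := hv
  rw [Projectivization.cross_mk_of_ne hu hv hpq]
  exact rep_mk _

theorem Rep.mem_submodule_iff {u : Fin 3 → ℝ} {p : P2} (hu : Rep u p) (v : Fin 3 → ℝ) :
    v ∈ p.submodule ↔ ∃ c : ℝ, c • u = v := by
  obtain ⟨hu, rfl⟩ := hu
  rw [Projectivization.submodule_mk, Submodule.mem_span_singleton]

theorem Rep.tendsto {I : Type*} {l : Filter I} {u : I → Fin 3 → ℝ} {u₀ : Fin 3 → ℝ} {p : I → P2}
    {p₀ : P2} (hp : ∀ i, Rep (u i) (p i)) (hp₀ : Rep u₀ p₀) (h : Tendsto u l (𝓝 u₀)) :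
    Tendsto p l (𝓝 p₀) := by
  have hcont : Continuous (Projectivization.mk' ℝ : {v : Fin 3 → ℝ // v ≠ 0} → P2) :=
    continuous_coinduced_rng
  obtain ⟨hu₀, rfl⟩ := hp₀
  choose hu hup using hp
  have h' : Tendsto (fun i => (⟨u i, hu i⟩ : {v : Fin 3 → ℝ // v ≠ 0})) l (𝓝 ⟨u₀, hu₀⟩) :=
    tendsto_subtype_rng.2 h
  have := (hcont.tendsto ⟨u₀, hu₀⟩).comp h'
  simpa [Function.comp_def, hup] using this

instance : T2Space P2 := by
  let F : {v : Fin 3 → ℝ // v ≠ 0} → Mat3 :=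
    fun v => (v.1 ⬝ᵥ v.1)⁻¹ • Matrix.vecMulVec v.1 v.1
  have hF : ∀ (a b : {v : Fin 3 → ℝ // v ≠ 0}) (t : ℝ), a.1 = t • b.1 → F a = F b := by
    intro a b t h
    have ht : t ≠ 0 := by
      rintro rfl
      exact a.2 (by simpa using h)
    simp only [F, h, smul_dotProduct, dotProduct_smul, Matrix.smul_vecMulVec,
      Matrix.vecMulVec_smul, smul_smul, smul_eq_mul]
    congr 1
    field_simp
  have hFc : Continuous F := by
    have hn : ∀ v : {v : Fin 3 → ℝ // v ≠ 0}, v.1 ⬝ᵥ v.1 ≠ 0 := fun v => by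
      simpa using v.2
    have h1 : Continuous fun v : {v : Fin 3 → ℝ // v ≠ 0} => v.1 ⬝ᵥ v.1 := by fun_prop
    have h2 : Continuous fun v : {v : Fin 3 → ℝ // v ≠ 0} => Matrix.vecMulVec v.1 v.1 := by
      fun_prop
    exact (h1.inv₀ hn).smul h2
  have hc : Continuous (Projectivization.lift F hF) := continuous_coinduced_dom.2 hFc
  refine T2Space.of_injective_continuous (f := Projectivization.lift F hF) ?_ hc
  intro p q hpq
  induction p using Projectivization.ind with | _ v hv =>
  induction q using Projectivization.ind with | _ w hw =>
  have h : F ⟨v, hv⟩ = F ⟨w, hw⟩ := hpq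
  have h' := congrArg (fun A : Mat3 => A *ᵥ v) h
  have hv' : v ⬝ᵥ v ≠ 0 := by simpa using hv
  simp only [F, Matrix.smul_mulVec, Matrix.vecMulVec_mulVec] at h'
  refine (Projectivization.mk_eq_mk_iff' ℝ _ _ _ _).2 ⟨(w ⬝ᵥ w)⁻¹ * (w ⬝ᵥ v), ?_⟩
  have h1 : (v ⬝ᵥ v)⁻¹ • MulOpposite.op (v ⬝ᵥ v) • v = v := by
    rw [op_smul_eq_smul, smul_smul, inv_mul_cancel₀ hv', one_smul]
  rw [h1, op_smul_eq_smul, smul_smul] at h'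
  exact h'.symm

theorem exists_tendsto_of_mem_compact {I X : Type*} [TopologicalSpace X] {K : Set X}
    (hK : IsCompact K) (l : Ultrafilter I) {u : I → X} (hu : ∀ i, u i ∈ K) :
    ∃ x ∈ K, Tendsto u l (𝓝 x) :=
  hK.ultrafilter_le_nhds' (l.map u) (Filter.univ_mem' hu : u ⁻¹' K ∈ (l : Filter I))

theorem hyperfilter_le_atTop : (hyperfilter ℕ : Filter ℕ) ≤ atTop := by
  rw [← Nat.cofinite_eq_atTop]
  exact hyperfilter_le_cofinite

theorem exists_rep_tendsto {I : Type*} (l : Ultrafilter I) {p : I → P2} {p₀ : P2}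
    (h : Tendsto p l (𝓝 p₀)) :
    ∃ (u : I → Fin 3 → ℝ) (u₀ : Fin 3 → ℝ), (∀ i, Rep (u i) (p i)) ∧ Rep u₀ p₀ ∧
      Tendsto u l (𝓝 u₀) := by
  let u : I → Fin 3 → ℝ := fun i => ‖(p i).rep‖⁻¹ • (p i).rep
  have hu : ∀ i, Rep (u i) (p i) := fun i =>
    (rep_rep (p i)).smul (inv_ne_zero (norm_ne_zero_iff.2 (p i).rep_nonzero))
  have hs : ∀ i, u i ∈ Metric.sphere (0 : Fin 3 → ℝ) 1 := fun i => by
    simp [u, norm_smul, (p i).rep_nonzero]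
  obtain ⟨u₀, hu₀, hlim⟩ := exists_tendsto_of_mem_compact (isCompact_sphere (0 : Fin 3 → ℝ) 1) l hs
  have hne : u₀ ≠ 0 := by
    rintro rfl
    simp at hu₀
  have := Rep.tendsto hu (rep_mk hne) hlim
  exact ⟨u, u₀, hu, tendsto_nhds_unique this h ▸ rep_mk hne, hlim⟩

/-- The triple product of the vectors of a frame. -/
def tripleProd (U : Fin 3 → Fin 3 → ℝ) : ℝ := U 0 ⬝ᵥ (U 1 ⨯₃ U 2)

/-- The vectors `U j` span the points of the frame `y`. -/
def FrameRep (U : Fin 3 → Fin 3 → ℝ) (y : Frame) : Prop := ∀ j, Rep (U j) (y.1 j)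

theorem FrameRep.tripleProd_ne_zero {U : Fin 3 → Fin 3 → ℝ} {y : Frame} (h : FrameRep U y) :
    tripleProd U ≠ 0 := by
  have hli := Projectivization.independent_iff.1 y.2
  choose d hd hU using fun j => (rep_rep (y.1 j)).eq_smul (h j)
  have : LinearIndependent ℝ U := by
    have h2 := hli.units_smul fun j => Units.mk0 (d j) (hd j)
    have h3 : ((fun j => Units.mk0 (d j) (hd j)) • Projectivization.rep ∘ y.1) = U := by
      funext j
      exact (hU j).symm
    exact h3 ▸ h2
  rw [tripleProd, triple_product_eq_det]
  have hdet := (Matrix.linearIndependent_rows_iff_isUnit (A := Matrix.of U)).1 this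
  rw [Matrix.isUnit_iff_isUnit_det] at hdet
  have hU : ![U 0, U 1, U 2] = U := by
    funext j
    fin_cases j <;> rfl
  rw [hU]
  exact hdet.ne_zero

theorem frameRep_rep (y : Frame) : FrameRep (fun j => (y.1 j).rep) y := fun _ => rep_rep _

theorem FrameRep.mulVec {U : Fin 3 → Fin 3 → ℝ} {y : Frame} (h : FrameRep U y) (g : SL(3, ℝ)) :
    FrameRep (fun j => g.1 *ᵥ U j) (g • y) := fun j => (h j).mulVec g

theorem exists_frameRep_tendsto {I : Type*} (l : Ultrafilter I) {y : I → Frame} {y₀ : Frame}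
    (h : Tendsto y l (𝓝 y₀)) :
    ∃ (U : I → Fin 3 → Fin 3 → ℝ) (U₀ : Fin 3 → Fin 3 → ℝ), (∀ i, FrameRep (U i) (y i)) ∧
      FrameRep U₀ y₀ ∧ Tendsto U l (𝓝 U₀) := by
  have h' : Tendsto (fun i => (y i).1) l (𝓝 y₀.1) := tendsto_subtype_rng.1 h
  rw [tendsto_pi_nhds] at h'
  choose u u₀ hu hu₀ hlim using fun j => exists_rep_tendsto l (h' j)
  exact ⟨fun i j => u j i, u₀, fun i j => hu j i, hu₀, tendsto_pi_nhds.2 hlim⟩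

theorem FrameRep.piPlus_pt {U : Fin 3 → Fin 3 → ℝ} {y : Frame} (h : FrameRep U y) :
    Rep (U 0) (piPlus y).pt := h 0

theorem FrameRep.piPlus_line {U : Fin 3 → Fin 3 → ℝ} {y : Frame} (h : FrameRep U y) :
    Rep (U 0 ⨯₃ U 1) (piPlus y).line := (h 0).cross (h 1) (y.injective.ne (by decide))

theorem FrameRep.piMinus_pt {U : Fin 3 → Fin 3 → ℝ} {y : Frame} (h : FrameRep U y) :
    Rep (U 2) (piMinus y).pt := h 2

theorem FrameRep.piMinus_line {U : Fin 3 → Fin 3 → ℝ} {y : Frame} (h : FrameRep U y) :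
    Rep (U 2 ⨯₃ U 1) (piMinus y).line := (h 2).cross (h 1) (y.injective.ne (by decide))

theorem tendsto_cross {I : Type*} {l : Filter I} {u v : I → Fin 3 → ℝ} {u₀ v₀ : Fin 3 → ℝ}
    (hu : Tendsto u l (𝓝 u₀)) (hv : Tendsto v l (𝓝 v₀)) :
    Tendsto (fun i => u i ⨯₃ v i) l (𝓝 (u₀ ⨯₃ v₀)) := by
  have hc : Continuous fun w : (Fin 3 → ℝ) × (Fin 3 → ℝ) => w.1 ⨯₃ w.2 := by
    simp only [cross_apply]
    refine continuous_pi fun j => ?_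
    fin_cases j <;> simp <;> fun_prop
  exact (hc.tendsto (u₀, v₀)).comp (hu.prodMk_nhds hv)

theorem tendsto_dotProduct {I : Type*} {l : Filter I} {u v : I → Fin 3 → ℝ} {u₀ v₀ : Fin 3 → ℝ}
    (hu : Tendsto u l (𝓝 u₀)) (hv : Tendsto v l (𝓝 v₀)) :
    Tendsto (fun i => u i ⬝ᵥ v i) l (𝓝 (u₀ ⬝ᵥ v₀)) := by
  have hc : Continuous fun w : (Fin 3 → ℝ) × (Fin 3 → ℝ) => w.1 ⬝ᵥ w.2 := by fun_prop
  exact (hc.tendsto (u₀, v₀)).comp (hu.prodMk_nhds hv)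

theorem tendsto_tripleProd {I : Type*} {l : Filter I} {U : I → Fin 3 → Fin 3 → ℝ}
    {U₀ : Fin 3 → Fin 3 → ℝ} (hU : Tendsto U l (𝓝 U₀)) :
    Tendsto (fun i => tripleProd (U i)) l (𝓝 (tripleProd U₀)) := by
  rw [tendsto_pi_nhds] at hU
  exact tendsto_dotProduct (hU 0) (tendsto_cross (hU 1) (hU 2))

theorem continuous_pt_piPlus : Continuous fun y : Frame => (piPlus y).pt :=
  (continuous_apply 0).comp continuous_subtype_val

theorem continuous_line_piPlus : Continuous fun y : Frame => (piPlus y).line := by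
  refine continuous_iff_ultrafilter.2 fun y l h => ?_
  obtain ⟨U, U₀, hU, hU₀, hlim⟩ := exists_frameRep_tendsto (y := id) l h
  rw [tendsto_pi_nhds] at hlim
  exact Rep.tendsto (fun i => (hU i).piPlus_line) hU₀.piPlus_line (tendsto_cross (hlim 0) (hlim 1))

/-- The dual action of a matrix of determinant one on cross products. -/
theorem dual_mulVec_cross (g : SL(3, ℝ)) (u v : Fin 3 → ℝ) :
    (dual g).1 *ᵥ (u ⨯₃ v) = (g.1 *ᵥ u) ⨯₃ (g.1 *ᵥ v) := by
  have h : (dual g).1 = g.1.adjugate.transpose := by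
    change (g⁻¹).1.transpose = _
    rw [Matrix.SpecialLinearGroup.coe_inv]
  rw [h]
  ext j
  fin_cases j <;>
    simp [Matrix.adjugate_fin_three, Matrix.mulVec, dotProduct, Fin.sum_univ_three,
      cross_apply] <;> ring

theorem vec_expansion (U : Fin 3 → Fin 3 → ℝ) (v : Fin 3 → ℝ) :
    tripleProd U • v = (v ⬝ᵥ (U 1 ⨯₃ U 2)) • U 0 + (v ⬝ᵥ (U 2 ⨯₃ U 0)) • U 1 +
      (v ⬝ᵥ (U 0 ⨯₃ U 1)) • U 2 := by
  ext j
  fin_cases j <;>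
    simp [tripleProd, dotProduct, Fin.sum_univ_three, cross_apply] <;> ring

/-- The frame of lines of a frame of points. -/
def dualFrame (U : Fin 3 → Fin 3 → ℝ) : Fin 3 → Fin 3 → ℝ :=
  ![U 0 ⨯₃ U 1, U 0 ⨯₃ U 2, U 1 ⨯₃ U 2]

theorem dualFrame_cross (U : Fin 3 → Fin 3 → ℝ) :
    dualFrame U 1 ⨯₃ dualFrame U 2 = tripleProd U • U 2 := by
  ext j
  fin_cases j <;>
    simp [dualFrame, tripleProd, dotProduct, Fin.sum_univ_three, cross_apply] <;> ring

theorem tripleProd_dualFrame (U : Fin 3 → Fin 3 → ℝ) :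
    tripleProd (dualFrame U) = tripleProd U ^ 2 := by
  simp [dualFrame, tripleProd, dotProduct, Fin.sum_univ_three, cross_apply]
  ring

theorem tendsto_dualFrame {I : Type*} {l : Filter I} {U : I → Fin 3 → Fin 3 → ℝ}
    {U₀ : Fin 3 → Fin 3 → ℝ} (hU : Tendsto U l (𝓝 U₀)) :
    Tendsto (fun i => dualFrame (U i)) l (𝓝 (dualFrame U₀)) := by
  rw [tendsto_pi_nhds] at hU ⊢
  intro j
  fin_cases j
  · exact tendsto_cross (hU 0) (hU 1)
  · exact tendsto_cross (hU 0) (hU 2)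
  · exact tendsto_cross (hU 1) (hU 2)

end AnosovFlag

namespace AnosovFlag

/-! ### Proximal dynamics -/

open Filter Topology
open scoped Matrix

section Proximal

variable {I : Type*} {l : Filter I}

/-- Matrices that map frames `U'` to frames `U` with dominant first multiplier attract vectors off
the plane of the last two vectors of `U'` to the first vector of `U`. -/
theorem tendsto_inv_smul_mulVec {g : I → Mat3} {U U' : I → Fin 3 → Fin 3 → ℝ}
    {U₀ U₀' : Fin 3 → Fin 3 → ℝ} {d : I → Fin 3 → ℝ}
    (hg : ∀ i j, g i *ᵥ U' i j = d i j • U i j) (hd : ∀ i j, d i j ≠ 0)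
    (h1 : Tendsto (fun i => d i 1 / d i 0) l (𝓝 0)) (h2 : Tendsto (fun i => d i 2 / d i 0) l (𝓝 0))
    (hU : Tendsto U l (𝓝 U₀)) (hU' : Tendsto U' l (𝓝 U₀')) {v : I → Fin 3 → ℝ} {v₀ : Fin 3 → ℝ}
    (hv : Tendsto v l (𝓝 v₀)) :
    Tendsto (fun i => (tripleProd (U' i) / d i 0) • (g i *ᵥ v i)) l
      (𝓝 ((v₀ ⬝ᵥ (U₀' 1 ⨯₃ U₀' 2)) • U₀ 0)) := by
  rw [tendsto_pi_nhds] at hU hU'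
  have key : ∀ i, (tripleProd (U' i) / d i 0) • (g i *ᵥ v i) =
      (v i ⬝ᵥ (U' i 1 ⨯₃ U' i 2)) • U i 0 +
      ((v i ⬝ᵥ (U' i 2 ⨯₃ U' i 0)) * (d i 1 / d i 0)) • U i 1 +
      ((v i ⬝ᵥ (U' i 0 ⨯₃ U' i 1)) * (d i 2 / d i 0)) • U i 2 := by
    intro i
    have h := congrArg (fun w => (d i 0)⁻¹ • (g i *ᵥ w)) (vec_expansion (U' i) (v i))
    simp only [Matrix.mulVec_add, Matrix.mulVec_smul, hg, smul_add, smul_smul] at h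
    rw [div_eq_inv_mul, h]
    have := hd i 0
    refine congrArg₂ _ (congrArg₂ _ ?_ ?_) ?_ <;> congr 1 <;> field_simp
  simp_rw [key]
  have := (((tendsto_dotProduct hv (tendsto_cross (hU' 1) (hU' 2))).smul (hU 0)).add
    (((tendsto_dotProduct hv (tendsto_cross (hU' 2) (hU' 0))).mul h1).smul (hU 1))).add
    (((tendsto_dotProduct hv (tendsto_cross (hU' 0) (hU' 1))).mul h2).smul (hU 2))
  simpa using this

theorem tendsto_smul_P2 {g : I → SL(3, ℝ)} {U U' : I → Fin 3 → Fin 3 → ℝ}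
    {U₀ U₀' : Fin 3 → Fin 3 → ℝ} {d : I → Fin 3 → ℝ}
    (hg : ∀ i j, (g i).1 *ᵥ U' i j = d i j • U i j) (hd : ∀ i j, d i j ≠ 0)
    (h1 : Tendsto (fun i => d i 1 / d i 0) l (𝓝 0)) (h2 : Tendsto (fun i => d i 2 / d i 1) l (𝓝 0))
    (hU : Tendsto U l (𝓝 U₀)) (hU' : Tendsto U' l (𝓝 U₀')) (hT : ∀ i, tripleProd (U' i) ≠ 0)
    {z : I → P2} {v : I → Fin 3 → ℝ} {v₀ : Fin 3 → ℝ} (hz : ∀ i, Rep (v i) (z i))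
    (hv : Tendsto v l (𝓝 v₀)) (hv₀ : v₀ ⬝ᵥ (U₀' 1 ⨯₃ U₀' 2) ≠ 0) {p : P2} (hp : Rep (U₀ 0) p) :
    Tendsto (fun i => g i • z i) l (𝓝 p) := by
  have h2' : Tendsto (fun i => d i 2 / d i 0) l (𝓝 0) := by
    have := h2.mul h1
    rw [mul_zero] at this
    refine this.congr fun i => ?_
    have := hd i 1
    field_simp
  exact Rep.tendsto
    (fun i => ((hz i).mulVec (g i)).smul (div_ne_zero (hT i) (hd i 0))) (hp.smul hv₀)
    (tendsto_inv_smul_mulVec hg hd h1 h2' hU hU' hv)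

theorem tendsto_dual_smul_P2 {g : I → SL(3, ℝ)} {U U' : I → Fin 3 → Fin 3 → ℝ}
    {U₀ U₀' : Fin 3 → Fin 3 → ℝ} {d : I → Fin 3 → ℝ}
    (hg : ∀ i j, (g i).1 *ᵥ U' i j = d i j • U i j) (hd : ∀ i j, d i j ≠ 0)
    (h1 : Tendsto (fun i => d i 1 / d i 0) l (𝓝 0)) (h2 : Tendsto (fun i => d i 2 / d i 1) l (𝓝 0))
    (hU : Tendsto U l (𝓝 U₀)) (hU' : Tendsto U' l (𝓝 U₀')) (hT : ∀ i, tripleProd (U' i) ≠ 0)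
    (hT₀ : tripleProd U₀' ≠ 0)
    {z : I → P2} {v : I → Fin 3 → ℝ} {v₀ : Fin 3 → ℝ} (hz : ∀ i, Rep (v i) (z i))
    (hv : Tendsto v l (𝓝 v₀)) (hv₀ : v₀ ⬝ᵥ U₀' 2 ≠ 0) {p : P2} (hp : Rep (U₀ 0 ⨯₃ U₀ 1) p) :
    Tendsto (fun i => dual (g i) • z i) l (𝓝 p) := by
  refine tendsto_smul_P2 (g := fun i => dual (g i)) (U := fun i => dualFrame (U i))
    (U' := fun i => dualFrame (U' i)) (d := fun i => ![d i 0 * d i 1, d i 0 * d i 2, d i 1 * d i 2])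
    ?_ ?_ ?_ ?_ (tendsto_dualFrame hU) (tendsto_dualFrame hU') ?_ hz hv ?_ hp
  · intro i j
    fin_cases j <;>
    · simp only [dualFrame]
      change (dual (g i)).1 *ᵥ (_ ⨯₃ _) = _ • (_ ⨯₃ _)
      rw [dual_mulVec_cross, hg, hg, map_smul, map_smul, LinearMap.smul_apply, smul_smul, mul_comm]
      rfl
  · intro i j
    fin_cases j <;> exact mul_ne_zero (hd i _) (hd i _)
  · refine h2.congr fun i => ?_
    have := hd i 0
    change _ = d i 0 * d i 2 / (d i 0 * d i 1)
    field_simp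
  · refine h1.congr fun i => ?_
    have := hd i 2
    change _ = d i 1 * d i 2 / (d i 0 * d i 2)
    field_simp
  · intro i
    rw [tripleProd_dualFrame]
    exact pow_ne_zero 2 (hT i)
  · rw [dualFrame_cross, dotProduct_smul]
    exact mul_ne_zero hT₀ hv₀

end Proximal

end AnosovFlag

namespace AnosovFlag

/-! ### Decompositions of `SL(2, ℝ)` -/

open Filter Topology
open scoped Matrix

/-- The square of the Frobenius norm on `SL(2, ℝ)`. -/
def normSq (h : SL(2, ℝ)) : ℝ := h.1 0 0 ^ 2 + h.1 0 1 ^ 2 + h.1 1 0 ^ 2 + h.1 1 1 ^ 2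

/-- The elements of `SO(2)`. -/
def IsRot (k : SL(2, ℝ)) : Prop := k.1 1 1 = k.1 0 0 ∧ k.1 0 1 = -k.1 1 0

theorem det_entries (h : SL(2, ℝ)) : h.1 0 0 * h.1 1 1 - h.1 0 1 * h.1 1 0 = 1 := by
  rw [← Matrix.det_fin_two]
  exact h.2

theorem mul_entry (g h : SL(2, ℝ)) (i j : Fin 2) :
    (g * h).1 i j = g.1 i 0 * h.1 0 j + g.1 i 1 * h.1 1 j := by
  change (g.1 * h.1) i j = _
  rw [Matrix.mul_apply, Fin.sum_univ_two]

theorem ext_entries {g h : SL(2, ℝ)} (h00 : g.1 0 0 = h.1 0 0) (h01 : g.1 0 1 = h.1 0 1)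
    (h10 : g.1 1 0 = h.1 1 0) (h11 : g.1 1 1 = h.1 1 1) : g = h := by
  apply Subtype.ext
  ext i j
  fin_cases i <;> fin_cases j <;> assumption

theorem continuous_entry (i j : Fin 2) : Continuous fun h : SL(2, ℝ) => h.1 i j :=
  (continuous_apply_apply i j).comp continuous_subtype_val

theorem continuous_normSq : Continuous normSq := by
  have h := continuous_entry
  unfold normSq
  exact ((((h 0 0).pow 2).add ((h 0 1).pow 2)).add ((h 1 0).pow 2)).add ((h 1 1).pow 2)

theorem tendsto_SL2 {I : Type*} {l : Filter I} {g : I → SL(2, ℝ)} {g₀ : SL(2, ℝ)}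
    (h : ∀ i j, Tendsto (fun n => (g n).1 i j) l (𝓝 (g₀.1 i j))) : Tendsto g l (𝓝 g₀) :=
  tendsto_subtype_rng.2 (tendsto_pi_nhds.2 fun i => tendsto_pi_nhds.2 fun j => h i j)

theorem isCompact_normSq_le (R : ℝ) : IsCompact {h : SL(2, ℝ) | normSq h ≤ R} := by
  have hemb : IsClosedEmbedding (fun h : SL(2, ℝ) => h.1) :=
    Matrix.SpecialLinearGroup.isClosedEmbedding_val
  have hK : IsCompact (Set.pi Set.univ fun _ : Fin 2 => Set.pi Set.univ fun _ : Fin 2 =>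
      Set.Icc (-(R + 1)) (R + 1)) :=
    isCompact_univ_pi fun _ => isCompact_univ_pi fun _ => isCompact_Icc
  refine (hemb.isCompact_preimage hK).of_isClosed_subset
    (isClosed_le continuous_normSq continuous_const) ?_
  intro h hh i _ j _
  have hh' : normSq h ≤ R := hh
  have h1 : h.1 i j ^ 2 ≤ R := by
    refine le_trans ?_ hh'
    unfold normSq
    fin_cases i <;> fin_cases j <;> simp only [Fin.zero_eta, Fin.mk_one] <;> nlinarith
      [sq_nonneg (h.1 0 0), sq_nonneg (h.1 0 1), sq_nonneg (h.1 1 0), sq_nonneg (h.1 1 1)]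
  constructor <;> nlinarith

theorem normSq_mul_of_isRot (h : SL(2, ℝ)) {k : SL(2, ℝ)} (hk : IsRot k) :
    normSq (h * k) = normSq h := by
  have hd := det_entries k
  rw [hk.1, hk.2] at hd
  simp only [normSq, mul_entry, hk.1, hk.2]
  linear_combination (h.1 0 0 ^ 2 + h.1 0 1 ^ 2 + h.1 1 0 ^ 2 + h.1 1 1 ^ 2) * hd

theorem normSq_of_isRot_mul {k : SL(2, ℝ)} (hk : IsRot k) (h : SL(2, ℝ)) :
    normSq (k * h) = normSq h := by
  have hd := det_entries k
  rw [hk.1, hk.2] at hd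
  simp only [normSq, mul_entry, hk.1, hk.2]
  linear_combination (h.1 0 0 ^ 2 + h.1 0 1 ^ 2 + h.1 1 0 ^ 2 + h.1 1 1 ^ 2) * hd

theorem normSq_of_isRot {k : SL(2, ℝ)} (hk : IsRot k) : normSq k = 2 := by
  rw [← mul_one k, normSq_of_isRot_mul hk]
  norm_num [normSq]

theorem IsRot.mul {k k' : SL(2, ℝ)} (hk : IsRot k) (hk' : IsRot k') : IsRot (k * k') := by
  constructor
  · rw [mul_entry, mul_entry, hk.1, hk.2, hk'.1, hk'.2]
    ring
  · rw [mul_entry, mul_entry, hk.1, hk.2, hk'.1, hk'.2]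
    ring

theorem diagFlow_entries (t : ℝ) : (diagFlow t).1 0 0 = Real.exp t ∧ (diagFlow t).1 0 1 = 0 ∧
    (diagFlow t).1 1 0 = 0 ∧ (diagFlow t).1 1 1 = Real.exp (-t) := ⟨rfl, rfl, rfl, rfl⟩

theorem diagFlow_add (s t : ℝ) : diagFlow (s + t) = diagFlow s * diagFlow t := by
  obtain ⟨a1, a2, a3, a4⟩ := diagFlow_entries (s + t)
  obtain ⟨b1, b2, b3, b4⟩ := diagFlow_entries s
  obtain ⟨c1, c2, c3, c4⟩ := diagFlow_entries t
  apply ext_entries <;> rw [mul_entry] <;> simp only [*, neg_add, Real.exp_add] <;> ring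

theorem diagFlow_zero : diagFlow 0 = 1 := by
  obtain ⟨a1, a2, a3, a4⟩ := diagFlow_entries 0
  apply ext_entries <;> simp [*]

theorem normSq_mul_diagFlow_le (h : SL(2, ℝ)) {t : ℝ} (ht : 0 ≤ t) :
    normSq (h * diagFlow t) ≤ Real.exp (2 * t) * normSq h := by
  obtain ⟨a1, a2, a3, a4⟩ := diagFlow_entries t
  simp only [normSq, mul_entry, a1, a2, a3, a4]
  have h1 : Real.exp (2 * t) = Real.exp t ^ 2 := by rw [← Real.exp_nat_mul]; norm_num
  have h2 : Real.exp (-t) ^ 2 ≤ Real.exp t ^ 2 := by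
    gcongr
    linarith
  rw [h1]
  nlinarith [mul_le_mul_of_nonneg_left h2 (sq_nonneg (h.1 0 1)),
    mul_le_mul_of_nonneg_left h2 (sq_nonneg (h.1 1 1))]

theorem exp_le_normSq_diagFlow (t : ℝ) : Real.exp (2 * t) ≤ normSq (diagFlow t) := by
  obtain ⟨a1, a2, a3, a4⟩ := diagFlow_entries t
  have h1 : Real.exp (2 * t) = Real.exp t ^ 2 := by rw [← Real.exp_nat_mul]; norm_num
  simp only [normSq, a1, a2, a3, a4, h1]
  nlinarith [sq_nonneg (Real.exp (-t))]

/-- The rotation of angle `π / 2`. -/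
def weyl : SL(2, ℝ) := ⟨!![0, -1; 1, 0], by simp⟩

theorem weyl_entries : weyl.1 0 0 = 0 ∧ weyl.1 0 1 = -1 ∧ weyl.1 1 0 = 1 ∧ weyl.1 1 1 = 0 :=
  ⟨rfl, rfl, rfl, rfl⟩

theorem isRot_weyl : IsRot weyl := by
  constructor
  · rfl
  · change (-1 : ℝ) = -1
    rfl

theorem diagFlow_mul_weyl (t : ℝ) : diagFlow t * weyl = weyl * diagFlow (-t) := by
  obtain ⟨a1, a2, a3, a4⟩ := diagFlow_entries t
  obtain ⟨b1, b2, b3, b4⟩ := diagFlow_entries (-t)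
  obtain ⟨c1, c2, c3, c4⟩ := weyl_entries
  apply ext_entries <;> rw [mul_entry, mul_entry] <;> simp [*]

/-- The element of `SO(2)` with a given first column. -/
def rotOf (x y : ℝ) (h : x ^ 2 + y ^ 2 = 1) : SL(2, ℝ) :=
  ⟨!![x, -y; y, x], by rw [Matrix.det_fin_two_of]; linear_combination h⟩

theorem rotOf_entries (x y : ℝ) (h : x ^ 2 + y ^ 2 = 1) : (rotOf x y h).1 0 0 = x ∧
    (rotOf x y h).1 0 1 = -y ∧ (rotOf x y h).1 1 0 = y ∧ (rotOf x y h).1 1 1 = x :=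
  ⟨rfl, rfl, rfl, rfl⟩

theorem isRot_rotOf (x y : ℝ) (h : x ^ 2 + y ^ 2 = 1) : IsRot (rotOf x y h) := ⟨rfl, rfl⟩

/-- The rotation whose first column is proportional to that of `h`. -/
theorem exists_isRot_first_column (h : SL(2, ℝ)) : ∃ (k : SL(2, ℝ)) (r : ℝ), IsRot k ∧ 0 < r ∧
    h.1 0 0 = r * k.1 0 0 ∧ h.1 1 0 = r * k.1 1 0 ∧ r ^ 2 = h.1 0 0 ^ 2 + h.1 1 0 ^ 2 := by
  have hpos : 0 < h.1 0 0 ^ 2 + h.1 1 0 ^ 2 := by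
    have hd := det_entries h
    by_contra hcon
    have h0 : h.1 0 0 = 0 := by nlinarith [sq_nonneg (h.1 0 0), sq_nonneg (h.1 1 0)]
    have h1 : h.1 1 0 = 0 := by nlinarith [sq_nonneg (h.1 0 0), sq_nonneg (h.1 1 0)]
    rw [h0, h1] at hd
    norm_num at hd
  set r := Real.sqrt (h.1 0 0 ^ 2 + h.1 1 0 ^ 2) with hr
  have hrpos : 0 < r := Real.sqrt_pos.2 hpos
  have hr2 : r ^ 2 = h.1 0 0 ^ 2 + h.1 1 0 ^ 2 := Real.sq_sqrt hpos.le
  refine ⟨rotOf (h.1 0 0 / r) (h.1 1 0 / r) ?_, r, isRot_rotOf _ _ _, hrpos, ?_, ?_, hr2⟩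
  · field_simp
    exact hr2.symm
  · rw [(rotOf_entries _ _ _).1]
    field_simp
  · rw [(rotOf_entries _ _ _).2.2.1]
    field_simp

/-- Iwasawa decomposition. -/
theorem exists_isRot_mul_upper (h : SL(2, ℝ)) :
    ∃ k b : SL(2, ℝ), IsRot k ∧ b.1 1 0 = 0 ∧ h = k * b := by
  obtain ⟨k, r, hk, hr, h0, h1, -⟩ := exists_isRot_first_column h
  refine ⟨k, k⁻¹ * h, hk, ?_, by group⟩
  rw [mul_entry, h0, h1, Matrix.SpecialLinearGroup.coe_inv, Matrix.adjugate_fin_two]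
  simp
  ring

theorem exists_orthogonal_columns (g : SL(2, ℝ)) : ∃ k : SL(2, ℝ), IsRot k ∧
    (g * k).1 0 0 * (g * k).1 0 1 + (g * k).1 1 0 * (g * k).1 1 1 = 0 := by
  let k : ℝ → SL(2, ℝ) := fun θ => rotOf (Real.cos θ) (Real.sin θ) (Real.cos_sq_add_sin_sq θ)
  let β : ℝ → ℝ := fun θ =>
    (g.1 0 0 * Real.cos θ + g.1 0 1 * Real.sin θ) * (g.1 0 0 * -Real.sin θ + g.1 0 1 * Real.cos θ) +
    (g.1 1 0 * Real.cos θ + g.1 1 1 * Real.sin θ) * (g.1 1 0 * -Real.sin θ + g.1 1 1 * Real.cos θ)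
  have hβ : Continuous β := by fun_prop
  have hneg : β (Real.pi / 2) = -β 0 := by
    simp [β]
    ring
  have hzero : ∃ θ, β θ = 0 := by
    rcases le_total (β 0) 0 with h | h
    · exact mem_range_of_exists_le_of_exists_ge hβ ⟨0, h⟩ ⟨Real.pi / 2, by rw [hneg]; linarith⟩
    · exact mem_range_of_exists_le_of_exists_ge hβ ⟨Real.pi / 2, by rw [hneg]; linarith⟩ ⟨0, h⟩
  obtain ⟨θ, hθ⟩ := hzero
  obtain ⟨a1, a2, a3, a4⟩ := rotOf_entries (Real.cos θ) (Real.sin θ) (Real.cos_sq_add_sin_sq θ)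
  refine ⟨k θ, isRot_rotOf _ _ _, ?_⟩
  simp only [mul_entry, k, a1, a2, a3, a4]
  exact hθ

/-- Cartan decomposition. -/
theorem exists_cartan (g : SL(2, ℝ)) : ∃ (k k' : SL(2, ℝ)) (t : ℝ), IsRot k ∧ IsRot k' ∧ 0 ≤ t ∧
    g * k' = k * diagFlow t := by
  have key : ∃ k' : SL(2, ℝ), IsRot k' ∧
      (g * k').1 0 0 * (g * k').1 0 1 + (g * k').1 1 0 * (g * k').1 1 1 = 0 ∧
      1 ≤ (g * k').1 0 0 ^ 2 + (g * k').1 1 0 ^ 2 := by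
    obtain ⟨k, hk, h0⟩ := exists_orthogonal_columns g
    by_cases h1 : 1 ≤ (g * k).1 0 0 ^ 2 + (g * k).1 1 0 ^ 2
    · exact ⟨k, hk, h0, h1⟩
    · obtain ⟨c1, c2, c3, c4⟩ := weyl_entries
      refine ⟨k * weyl, hk.mul isRot_weyl, ?_, ?_⟩
      · rw [← mul_assoc, mul_entry (g * k), mul_entry (g * k), mul_entry (g * k),
          mul_entry (g * k), c1, c2, c3, c4]
        linear_combination -h0
      · rw [← mul_assoc, mul_entry (g * k), mul_entry (g * k), c1, c3]
        have hd := det_entries (g * k)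
        push Not at h1
        by_contra hcon
        push Not at hcon
        nlinarith [sq_nonneg ((g * k).1 0 0), sq_nonneg ((g * k).1 0 1),
          sq_nonneg ((g * k).1 1 0), sq_nonneg ((g * k).1 1 1)]
  obtain ⟨k', hk', h0, h1⟩ := key
  obtain ⟨k, r, hk, hr, e0, e1, hr2⟩ := exists_isRot_first_column (g * k')
  have hr1 : 1 ≤ r := by nlinarith
  refine ⟨k, k', Real.log r, hk, hk', Real.log_nonneg hr1, ?_⟩
  obtain ⟨a1, a2, a3, a4⟩ := diagFlow_entries (Real.log r)
  have hd := det_entries (g * k')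
  have hdk := det_entries k
  rw [hk.1, hk.2] at hdk
  rw [e0, e1] at hd h0
  rw [Real.exp_neg, Real.exp_log hr] at a4
  rw [Real.exp_log hr] at a1
  apply ext_entries
  · rw [mul_entry k, a1, a3, e0]; ring
  · rw [mul_entry k, a2, a4, hk.2]
    field_simp
    linear_combination k.1 0 0 * h0 - k.1 1 0 * hd - r * (g * k').1 0 1 * hdk
  · rw [mul_entry k, a1, a3, e1]; ring
  · rw [mul_entry k, a2, a4, hk.1]
    field_simp
    linear_combination k.1 1 0 * h0 + k.1 0 0 * hd - r * (g * k').1 1 1 * hdk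

theorem tendsto_diagFlow_conj {b : SL(2, ℝ)} (hb : b.1 1 0 = 0) :
    ∃ b₀ : SL(2, ℝ), Tendsto (fun n : ℕ => diagFlow (-(n : ℝ)) * b * diagFlow n) atTop (𝓝 b₀) := by
  have hd := det_entries b
  rw [hb, mul_zero, sub_zero] at hd
  refine ⟨⟨!![b.1 0 0, 0; 0, b.1 1 1], by rw [Matrix.det_fin_two_of]; linear_combination hd⟩,
    tendsto_SL2 fun i j => ?_⟩
  have e : ∀ n : ℕ, Real.exp (-(n : ℝ)) * Real.exp n = 1 := fun n => by
    rw [← Real.exp_add]; simp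
  fin_cases i <;> fin_cases j <;> simp only [Fin.zero_eta, Fin.mk_one, mul_entry, diagFlow_entries]
  · simp only [hb, zero_mul, mul_zero, add_zero]
    refine tendsto_const_nhds.congr fun n => ?_
    change b.1 0 0 = _
    linear_combination -b.1 0 0 * e n
  · have : Tendsto (fun n : ℕ => b.1 0 1 * Real.exp (-(n : ℝ)) ^ 2) atTop (𝓝 (b.1 0 1 * 0 ^ 2)) :=
      ((Real.tendsto_exp_neg_atTop_nhds_zero.comp tendsto_natCast_atTop_atTop).pow 2).const_mul _
    simp only [ne_eq, OfNat.ofNat_ne_zero, not_false_eq_true, zero_pow, mul_zero] at this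
    refine this.congr fun n => ?_
    ring
  · simp only [hb, zero_mul, mul_zero, add_zero]
    exact tendsto_const_nhds
  · simp only [hb, zero_mul, mul_zero, zero_add, neg_neg]
    refine tendsto_const_nhds.congr fun n => ?_
    change b.1 1 1 = _
    linear_combination -b.1 1 1 * e n

end AnosovFlag

noncomputable section

namespace AnosovFlag

/-! ### Distance to a discrete subgroup -/

open Filter Topology
open scoped Matrix

section OrbitDist

variable {Γ : Type*} [Group Γ] (ι : Γ →* SL(2, ℝ))

/-- The least squared norm of the elements of the orbit of `h`. -/
def orbitDist (h : SL(2, ℝ)) : ℝ := ⨅ γ : Γ, normSq ((ι γ)⁻¹ * h)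

theorem normSq_nonneg (h : SL(2, ℝ)) : 0 ≤ normSq h := by
  unfold normSq
  positivity

theorem orbitDist_le (h : SL(2, ℝ)) (γ : Γ) : orbitDist ι h ≤ normSq ((ι γ)⁻¹ * h) :=
  ciInf_le ⟨0, by rintro _ ⟨γ, rfl⟩; exact normSq_nonneg _⟩ γ

theorem orbitDist_mul (α : Γ) (h : SL(2, ℝ)) : orbitDist ι (ι α * h) = orbitDist ι h := by
  unfold orbitDist
  rw [← (Equiv.mulLeft α).surjective.iInf_comp]
  congr 1
  funext γ
  simp [mul_assoc]

theorem orbitDist_mul_of_isRot (h : SL(2, ℝ)) {k : SL(2, ℝ)} (hk : IsRot k) :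
    orbitDist ι (h * k) = orbitDist ι h := by
  unfold orbitDist
  simp_rw [← mul_assoc, normSq_mul_of_isRot _ hk]

variable {ι}

theorem finite_mem_compact (hι : Function.Injective ι) (hdisc : DiscreteTopology ι.range)
    {K : Set SL(2, ℝ)} (hK : IsCompact K) : {γ | ι γ ∈ K}.Finite := by
  have hT : T2Space SL(2, ℝ) := inferInstanceAs (T2Space (Subtype _))
  have h := MonoidHom.tendsto_coe_cofinite_of_discrete hι (isDiscrete_iff_discreteTopology.2 hdisc)
  have := h hK.compl_mem_cocompact
  rw [Filter.mem_map, Filter.mem_cofinite, ← Set.preimage_compl, compl_compl] at this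
  exact this

theorem finite_normSq_le (hι : Function.Injective ι) (hdisc : DiscreteTopology ι.range)
    (R R' : ℝ) :
    {γ | ∃ h, normSq h ≤ R ∧ normSq ((ι γ)⁻¹ * h) ≤ R'}.Finite := by
  refine (finite_mem_compact hι hdisc
    ((isCompact_normSq_le R).mul (isCompact_normSq_le R').inv)).subset ?_
  rintro γ ⟨h, h1, h2⟩
  exact ⟨h, h1, ((ι γ)⁻¹ * h)⁻¹, by simpa using h2, by group⟩

theorem exists_orbitDist_eq (hι : Function.Injective ι) (hdisc : DiscreteTopology ι.range)
    (h : SL(2, ℝ)) : ∃ γ : Γ, orbitDist ι h = normSq ((ι γ)⁻¹ * h) := by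
  have hfin : {γ | normSq ((ι γ)⁻¹ * h) ≤ normSq h}.Finite :=
    (finite_normSq_le hι hdisc (normSq h) (normSq h)).subset fun γ hγ => ⟨h, le_rfl, hγ⟩
  obtain ⟨γ, hγ, hmin⟩ := Set.exists_min_image _ (fun γ => normSq ((ι γ)⁻¹ * h)) hfin ⟨1, by simp⟩
  refine ⟨γ, le_antisymm (orbitDist_le ι h γ) (le_ciInf fun α => ?_)⟩
  by_cases hα : normSq ((ι α)⁻¹ * h) ≤ normSq h
  · exact hmin α hα
  · exact le_trans hγ (not_le.1 hα).le

theorem continuous_orbitDist (hι : Function.Injective ι) (hdisc : DiscreteTopology ι.range) :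
    Continuous (orbitDist ι) := by
  refine continuous_iff_continuousAt.2 fun h₀ => ?_
  let R := normSq h₀ + 1
  have hfin := finite_normSq_le hι hdisc R R
  have hne : hfin.toFinset.Nonempty :=
    ⟨1, by simpa using ⟨h₀, by simp [R]⟩⟩
  have hc : Continuous fun h => hfin.toFinset.inf' hne fun γ => normSq ((ι γ)⁻¹ * h) :=
    Continuous.finset_inf'_apply hne fun γ _ => continuous_normSq.comp (continuous_const_mul _)
  refine hc.continuousAt.congr ?_
  have hW : ∀ᶠ h in 𝓝 h₀, normSq h < R :=
    continuous_normSq.continuousAt.eventually_lt continuousAt_const (by simp [R])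
  filter_upwards [hW] with h hh
  apply le_antisymm
  · obtain ⟨γ, hγ⟩ := exists_orbitDist_eq hι hdisc h
    rw [hγ]
    refine Finset.inf'_le (fun γ => normSq ((ι γ)⁻¹ * h)) ?_
    have h1 := orbitDist_le ι h 1
    rw [map_one, inv_one, one_mul, hγ] at h1
    simpa using ⟨h, hh.le, h1.trans hh.le⟩
  · exact Finset.le_inf' _ _ fun γ _ => orbitDist_le ι h γ

end OrbitDist

/-! ### Norms on the tangent spaces of the frame variety -/

theorem cross_eq_zero_iff {u : Fin 3 → ℝ} (hu : u ≠ 0) (v : Fin 3 → ℝ) :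
    v ⨯₃ u = 0 ↔ ∃ c : ℝ, c • u = v := by
  rw [← not_iff_not, ← cross_anticomm, neg_eq_zero]
  rw [← ne_eq, crossProduct_ne_zero_iff_linearIndependent, LinearIndependent.pair_iff' hu]
  simp

theorem Rep.preservesLine_iff {u : Fin 3 → ℝ} {p : P2} (hu : Rep u p) (A : Mat3) :
    PreservesLine A p ↔ ∃ c : ℝ, c • u = A *ᵥ u := by
  constructor
  · intro h
    exact (hu.mem_submodule_iff _).1 (h u ((hu.mem_submodule_iff _).2 ⟨1, one_smul _ _⟩))
  · rintro ⟨c, hc⟩ v hv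
    obtain ⟨d, rfl⟩ := (hu.mem_submodule_iff _).1 hv
    refine (hu.mem_submodule_iff _).2 ⟨d * c, ?_⟩
    rw [Matrix.mulVec_smul, ← hc, smul_smul]

theorem coe_inv_mul (g : SL(3, ℝ)) : (g⁻¹).1 * g.1 = 1 := congrArg Subtype.val (inv_mul_cancel g)

theorem coe_mul_inv (g : SL(3, ℝ)) : g.1 * (g⁻¹).1 = 1 := congrArg Subtype.val (mul_inv_cancel g)

theorem preservesLine_conj (g : SL(3, ℝ)) (A : Mat3) (p : P2) :
    PreservesLine (g.1 * A * (g⁻¹).1) (g • p) ↔ PreservesLine A p := by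
  rw [((rep_rep p).mulVec g).preservesLine_iff, (rep_rep p).preservesLine_iff]
  refine exists_congr fun c => ?_
  rw [Matrix.mulVec_mulVec, mul_assoc, coe_inv_mul, mul_one, ← Matrix.mulVec_mulVec,
    ← Matrix.mulVec_smul]
  constructor
  · intro h
    have := congrArg (fun w => (g⁻¹).1 *ᵥ w) h
    simp only [Matrix.mulVec_mulVec] at this
    rwa [← mul_assoc, coe_inv_mul, one_mul, Matrix.one_mulVec] at this
  · intro h
    rw [h]

theorem fixesFrame_conj (g : SL(3, ℝ)) (A : Mat3) (y : Frame) :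
    FixesFrame (g.1 * A * (g⁻¹).1) (g • y) ↔ FixesFrame A y :=
  forall_congr' fun j => preservesLine_conj g A (y.1 j)

/-- The norm on the tangent space of the projective plane at `p`. -/
def pointSeminorm (p : P2) : Seminorm ℝ Mat3 :=
  Seminorm.of (fun A => ‖(A *ᵥ p.rep) ⨯₃ p.rep‖ / ‖p.rep‖ ^ 2)
    (fun A B => by
      rw [Matrix.add_mulVec, map_add, LinearMap.add_apply, ← add_div]
      gcongr
      exact norm_add_le _ _)
    (fun c A => by
      rw [Matrix.smul_mulVec, map_smul, LinearMap.smul_apply, norm_smul, mul_div_assoc])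

theorem Rep.pointSeminorm_eq {u : Fin 3 → ℝ} {p : P2} (hu : Rep u p) (A : Mat3) :
    pointSeminorm p A = ‖(A *ᵥ u) ⨯₃ u‖ / ‖u‖ ^ 2 := by
  obtain ⟨d, hd, rfl⟩ := (rep_rep p).eq_smul hu
  change ‖(A *ᵥ p.rep) ⨯₃ p.rep‖ / ‖p.rep‖ ^ 2 = _
  have hd' : ‖d‖ ≠ 0 := norm_ne_zero_iff.2 hd
  have hp : ‖p.rep‖ ≠ 0 := norm_ne_zero_iff.2 p.rep_nonzero
  rw [Matrix.mulVec_smul, map_smul, map_smul, LinearMap.smul_apply, smul_smul, norm_smul,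
    norm_smul, norm_mul]
  field_simp

theorem pointSeminorm_eq_zero_iff (p : P2) (A : Mat3) :
    pointSeminorm p A = 0 ↔ PreservesLine A p := by
  rw [(rep_rep p).pointSeminorm_eq, (rep_rep p).preservesLine_iff,
    ← cross_eq_zero_iff p.rep_nonzero]
  have hp : ‖p.rep‖ ≠ 0 := norm_ne_zero_iff.2 p.rep_nonzero
  simp [hp]

theorem continuous_pointSeminorm : Continuous fun x : P2 × Mat3 => pointSeminorm x.1 x.2 := by
  refine continuous_iff_ultrafilter.2 fun x l h => ?_
  obtain ⟨u, u₀, hu, hu₀, hlim⟩ := exists_rep_tendsto (p := Prod.fst) l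
    (continuous_fst.continuousAt.tendsto.mono_left h)
  have hA : Tendsto (fun x : P2 × Mat3 => x.2) l (𝓝 x.2) :=
    continuous_snd.continuousAt.tendsto.mono_left h
  rw [hu₀.pointSeminorm_eq]
  simp_rw [fun x : P2 × Mat3 => (hu x).pointSeminorm_eq]
  have hc : Continuous fun w : Mat3 × (Fin 3 → ℝ) => w.1 *ᵥ w.2 := by fun_prop
  have hAu : Tendsto (fun x : P2 × Mat3 => x.2 *ᵥ u x) l (𝓝 (x.2 *ᵥ u₀)) :=
    (hc.tendsto (x.2, u₀)).comp (hA.prodMk_nhds hlim)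
  obtain ⟨hne, -⟩ := hu₀
  exact (tendsto_cross hAu hlim).norm.div (hlim.norm.pow 2)
    (pow_ne_zero 2 (norm_ne_zero_iff.2 hne))

/-- A norm on the tangent space of the frame variety at `y`. -/
def frameSeminorm (y : Frame) : Seminorm ℝ Mat3 :=
  pointSeminorm (y.1 0) + pointSeminorm (y.1 1) + pointSeminorm (y.1 2)

theorem frameSeminorm_apply (y : Frame) (A : Mat3) : frameSeminorm y A =
    pointSeminorm (y.1 0) A + pointSeminorm (y.1 1) A + pointSeminorm (y.1 2) A := rfl

theorem frameSeminorm_eq_zero_iff (y : Frame) (A : Mat3) :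
    frameSeminorm y A = 0 ↔ FixesFrame A y := by
  have h := fun j => apply_nonneg (pointSeminorm (y.1 j)) A
  rw [frameSeminorm_apply, add_eq_zero_iff_of_nonneg (add_nonneg (h 0) (h 1)) (h 2),
    add_eq_zero_iff_of_nonneg (h 0) (h 1)]
  simp only [pointSeminorm_eq_zero_iff, FixesFrame, Fin.forall_fin_succ]
  simp [and_assoc]

theorem continuous_frame_apply (j : Fin 3) : Continuous fun y : Frame => y.1 j :=
  (continuous_apply j).comp continuous_subtype_val

theorem continuous_frameSeminorm : Continuous fun x : Frame × Mat3 => frameSeminorm x.1 x.2 := by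
  simp only [frameSeminorm_apply]
  have h : ∀ j, Continuous fun x : Frame × Mat3 => pointSeminorm (x.1.1 j) x.2 := fun j => by
    have h1 : Continuous fun x : Frame × Mat3 => x.1.1 j :=
      (continuous_frame_apply j).comp continuous_fst
    have h2 : Continuous fun x : Frame × Mat3 => (x.1.1 j, x.2) := h1.prodMk continuous_snd
    have h3 := continuous_pointSeminorm.comp h2
    exact h3
  exact ((h 0).add (h 1)).add (h 2)

theorem continuous_smul_P2 (g : SL(3, ℝ)) : Continuous fun p : P2 => g • p := by
  refine continuous_iff_ultrafilter.2 fun p l h => ?_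
  obtain ⟨u, u₀, hu, hu₀, hlim⟩ := exists_rep_tendsto (p := id) l h
  have hc : Continuous fun w : Fin 3 → ℝ => g.1 *ᵥ w := by fun_prop
  exact Rep.tendsto (fun i => (hu i).mulVec g) (hu₀.mulVec g) ((hc.tendsto u₀).comp hlim)

theorem continuous_smul_frame (g : SL(3, ℝ)) : Continuous fun y : Frame => g • y :=
  Continuous.subtype_mk (continuous_pi fun j =>
    (continuous_smul_P2 g).comp (continuous_frame_apply j)) _

/-! ### Existence of vertical norms -/

section VerticalNorm

variable {Γ : Type*} [Group Γ] (ι : Γ →* SL(2, ℝ)) (ρ : Γ →* SL(3, ℝ))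

/-- A function whose translates form a locally finite cover by their supports. -/
def cutoff (h : SL(2, ℝ)) : ℝ := max 0 (1 + orbitDist ι h - normSq h)

/-- The translate by `γ` of the cut off norm. -/
def translatedNorm (h : SL(2, ℝ)) (y : Frame) (γ : Γ) (A : Mat3) : ℝ :=
  cutoff ι ((ι γ)⁻¹ * h) * frameSeminorm ((ρ γ)⁻¹ • y) (((ρ γ)⁻¹).1 * A * (ρ γ).1)

variable {ι}

theorem normSq_lt_of_cutoff_ne_zero {h : SL(2, ℝ)} {γ : Γ} (hc : cutoff ι ((ι γ)⁻¹ * h) ≠ 0) :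
    normSq ((ι γ)⁻¹ * h) < 1 + normSq h := by
  have h1 : 0 < 1 + orbitDist ι ((ι γ)⁻¹ * h) - normSq ((ι γ)⁻¹ * h) := by
    by_contra hcon
    exact hc (max_eq_left (not_lt.1 hcon))
  have h2 := orbitDist_le ι ((ι γ)⁻¹ * h) γ⁻¹
  simp only [map_inv, inv_inv, mul_inv_cancel_left] at h2
  linarith

theorem translatedNorm_nonneg (h : SL(2, ℝ)) (y : Frame) (γ : Γ) (A : Mat3) :
    0 ≤ translatedNorm ι ρ h y γ A := mul_nonneg (le_max_left _ _) (apply_nonneg _ _)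

theorem finite_support_translatedNorm (hι : Function.Injective ι) (hdisc : DiscreteTopology ι.range)
    (h : SL(2, ℝ)) (y : Frame) (A : Mat3) :
    (Function.support fun γ => translatedNorm ι ρ h y γ A).Finite :=
  (finite_normSq_le hι hdisc (normSq h) (1 + normSq h)).subset fun _ hγ =>
    ⟨h, le_rfl, (normSq_lt_of_cutoff_ne_zero (left_ne_zero_of_mul hγ)).le⟩

theorem continuous_cutoff (hι : Function.Injective ι) (hdisc : DiscreteTopology ι.range) :
    Continuous (cutoff ι) :=
  continuous_const.max
    ((continuous_const.add (continuous_orbitDist hι hdisc)).sub continuous_normSq)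

theorem continuous_finsum_translatedNorm (hι : Function.Injective ι)
    (hdisc : DiscreteTopology ι.range) :
   
    Continuous fun x : SL(2, ℝ) × Frame × Mat3 =>
      ∑ᶠ γ, translatedNorm ι ρ x.1 x.2.1 γ x.2.2 := by
  refine continuous_finsum (fun γ => ?_) ?_
  · have h1 : Continuous fun x : SL(2, ℝ) × Frame × Mat3 => cutoff ι ((ι γ)⁻¹ * x.1) :=
      (continuous_cutoff hι hdisc).comp ((continuous_const_mul _).comp continuous_fst)
    have h2 : Continuous fun x : SL(2, ℝ) × Frame × Mat3 => (ρ γ)⁻¹ • x.2.1 :=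
      (continuous_smul_frame _).comp (continuous_fst.comp continuous_snd)
    have h3 : Continuous fun x : SL(2, ℝ) × Frame × Mat3 => ((ρ γ)⁻¹).1 * x.2.2 * (ρ γ).1 := by
      fun_prop
    have h4 := continuous_frameSeminorm.comp (h2.prodMk h3)
    exact h1.mul h4
  · rintro ⟨h₀, y₀, A₀⟩
    refine ⟨{x | normSq x.1 < normSq h₀ + 1}, ?_, ?_⟩
    · exact (continuous_normSq.comp continuous_fst).continuousAt.eventually_lt continuousAt_const
        (by simp)
    · refine (finite_normSq_le hι hdisc (normSq h₀ + 1) (1 + (normSq h₀ + 1))).subset ?_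
      rintro γ ⟨x, hx, hx'⟩
      have hx'' : normSq x.1 < normSq h₀ + 1 := hx'
      refine ⟨x.1, hx''.le, (normSq_lt_of_cutoff_ne_zero (left_ne_zero_of_mul hx)).le.trans ?_⟩
      linarith

/-- The vertical norm obtained by averaging, scaled by a positive invariant function. -/
def averagedNorm (hι : Function.Injective ι) (hdisc : DiscreteTopology ι.range)
    (φ : SL(2, ℝ) → ℝ) (hφ : Continuous φ) (hpos : ∀ h, 0 < φ h)
    (hinv : ∀ γ h, φ (ι γ * h) = φ h) : VerticalNorm ι ρ where
  norm h y := Seminorm.of (fun A => φ h * ∑ᶠ γ, translatedNorm ι ρ h y γ A)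
    (fun A B => by
      rw [← mul_add, ← finsum_add_distrib (finite_support_translatedNorm ρ hι hdisc h y A)
        (finite_support_translatedNorm ρ hι hdisc h y B)]
      refine mul_le_mul_of_nonneg_left (finsum_le_finsum'
        (finite_support_translatedNorm ρ hι hdisc h y _) ?_ fun γ => ?_) (hpos h).le
      · exact ((finite_support_translatedNorm ρ hι hdisc h y A).union
          (finite_support_translatedNorm ρ hι hdisc h y B)).subset (Function.support_add _ _)
      · simp only [translatedNorm]
        rw [← mul_add, mul_add, add_mul]
        exact mul_le_mul_of_nonneg_left (map_add_le_add _ _ _) (le_max_left _ _))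
    (fun c A => by
      rw [mul_left_comm, ← smul_eq_mul ‖c‖, ← smul_eq_mul (φ h), ← smul_eq_mul (φ h),
        smul_finsum ‖c‖]
      congr 1
      refine finsum_congr fun γ => ?_
      rw [translatedNorm, Matrix.mul_smul, Matrix.smul_mul, map_smul_eq_mul, translatedNorm,
        smul_eq_mul]
      ring)
  norm_eq_zero_iff h y A := by
    change φ h * ∑ᶠ γ, translatedNorm ι ρ h y γ A = 0 ↔ _
    rw [mul_eq_zero, or_iff_right (hpos h).ne']
    have hiff : ∀ γ : Γ, frameSeminorm ((ρ γ)⁻¹ • y) (((ρ γ)⁻¹).1 * A * (ρ γ).1) = 0 ↔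
        FixesFrame A y := fun γ => by
      rw [frameSeminorm_eq_zero_iff]
      have := fixesFrame_conj (ρ γ)⁻¹ A y
      rwa [inv_inv] at this
    constructor
    · intro hsum
      obtain ⟨γ, hγ⟩ := exists_orbitDist_eq hι hdisc h
      have h0 := single_le_finsum γ (finite_support_translatedNorm ρ hι hdisc h y A)
        (fun γ => translatedNorm_nonneg (ι := ι) ρ h y γ A)
      rw [hsum] at h0
      have h1 := le_antisymm h0 (translatedNorm_nonneg ρ h y γ A)
      have h2 : cutoff ι ((ι γ)⁻¹ * h) = 1 := by
        rw [cutoff, ← map_inv, orbitDist_mul, map_inv, hγ]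
        simp
      rw [translatedNorm, h2, one_mul] at h1
      exact (hiff γ).1 h1
    · intro hA
      refine finsum_eq_zero_of_forall_eq_zero fun γ => ?_
      rw [translatedNorm, (hiff γ).2 hA, mul_zero]
  continuous_norm := (hφ.comp continuous_fst).mul (continuous_finsum_translatedNorm ρ hι hdisc)
  norm_smul α h y A := by
    change φ _ * _ = φ h * _
    rw [hinv]
    congr 1
    rw [← finsum_comp_equiv (Equiv.mulLeft α)]
    refine finsum_congr fun γ => ?_
    have e1 : (ι (α * γ))⁻¹ * (ι α * h) = (ι γ)⁻¹ * h := by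
      rw [map_mul]; group
    have e2 : (ρ (α * γ))⁻¹ • ρ α • y = (ρ γ)⁻¹ • y := by
      rw [smul_smul, map_mul]; congr 1; group
    have e3 : ((ρ (α * γ))⁻¹).1 * ((ρ α).1 * A * ((ρ α)⁻¹).1) * (ρ (α * γ)).1 =
        ((ρ γ)⁻¹).1 * A * (ρ γ).1 := by
      have a1 : ((ρ (α * γ))⁻¹).1 * (ρ α).1 = ((ρ γ)⁻¹).1 :=
        congrArg Subtype.val (show (ρ (α * γ))⁻¹ * ρ α = (ρ γ)⁻¹ by rw [map_mul]; group)
      have a2 : ((ρ α)⁻¹).1 * (ρ (α * γ)).1 = (ρ γ).1 :=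
        congrArg Subtype.val (show (ρ α)⁻¹ * ρ (α * γ) = ρ γ by rw [map_mul]; group)
      rw [← a1, ← a2]
      simp only [mul_assoc]
    simp only [translatedNorm, Equiv.coe_mulLeft]
    rw [e1, e2]
    exact congrArg (fun B => _ * frameSeminorm _ B) e3

theorem averagedNorm_apply (hι : Function.Injective ι) (hdisc : DiscreteTopology ι.range)
    (φ : SL(2, ℝ) → ℝ) (hφ : Continuous φ) (hpos : ∀ h, 0 < φ h)
    (hinv : ∀ γ h, φ (ι γ * h) = φ h) (h : SL(2, ℝ)) (y : Frame) (A : Mat3) :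
    (averagedNorm ρ hι hdisc φ hφ hpos hinv).norm h y A =
      φ h * ∑ᶠ γ, translatedNorm ι ρ h y γ A := rfl

end VerticalNorm

end AnosovFlag

end

noncomputable section

namespace AnosovFlag

/-! ### Root vectors of a frame -/

open Filter Topology
open scoped Matrix

/-- The matrix that maps `U 1` to `U 0` and kills `U 0` and `U 2`. -/
def rootOne (U : Fin 3 → Fin 3 → ℝ) : Mat3 :=
  (tripleProd U)⁻¹ • Matrix.vecMulVec (U 0) (U 2 ⨯₃ U 0)

/-- The matrix that maps `U 2` to `U 1` and kills `U 0` and `U 1`. -/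
def rootTwo (U : Fin 3 → Fin 3 → ℝ) : Mat3 :=
  (tripleProd U)⁻¹ • Matrix.vecMulVec (U 1) (U 0 ⨯₃ U 1)

theorem vecMulVec_mulVec' (u m v : Fin 3 → ℝ) :
    Matrix.vecMulVec u m *ᵥ v = (m ⬝ᵥ v) • u := by
  rw [Matrix.vecMulVec_mulVec, op_smul_eq_smul]

theorem fixesFlag_rootOne {U : Fin 3 → Fin 3 → ℝ} {y : Frame} (h : FrameRep U y) :
    FixesFlag (rootOne U) (piPlus y) := by
  refine ⟨(h.piPlus_pt.preservesLine_iff _).2 ⟨0, ?_⟩,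
    (h.piPlus_line.preservesLine_iff _).2 ⟨0, ?_⟩⟩
  · rw [rootOne, Matrix.smul_mulVec, vecMulVec_mulVec', dotProduct_comm, dot_cross_self]
    simp
  · rw [rootOne, Matrix.transpose_smul, Matrix.transpose_vecMulVec, Matrix.smul_mulVec,
      vecMulVec_mulVec', dot_self_cross]
    simp

theorem fixesFlag_rootTwo {U : Fin 3 → Fin 3 → ℝ} {y : Frame} (h : FrameRep U y) :
    FixesFlag (rootTwo U) (piPlus y) := by
  refine ⟨(h.piPlus_pt.preservesLine_iff _).2 ⟨0, ?_⟩,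
    (h.piPlus_line.preservesLine_iff _).2 ⟨0, ?_⟩⟩
  · rw [rootTwo, Matrix.smul_mulVec, vecMulVec_mulVec', dotProduct_comm, dot_self_cross]
    simp
  · rw [rootTwo, Matrix.transpose_smul, Matrix.transpose_vecMulVec, Matrix.smul_mulVec,
      vecMulVec_mulVec', dot_cross_self]
    simp

theorem not_fixesFrame_rootOne {U : Fin 3 → Fin 3 → ℝ} {y : Frame} (h : FrameRep U y) :
    ¬ FixesFrame (rootOne U) y := by
  intro hA
  obtain ⟨c, hc⟩ := ((h 1).preservesLine_iff _).1 (hA 1)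
  have hT := h.tripleProd_ne_zero
  have h1 : (U 2 ⨯₃ U 0) ⬝ᵥ U 1 = tripleProd U := by
    rw [dotProduct_comm, tripleProd, triple_product_permutation, triple_product_permutation]
  rw [rootOne, Matrix.smul_mulVec, vecMulVec_mulVec', h1, smul_smul, inv_mul_cancel₀ hT,
    one_smul] at hc
  apply hT
  rw [tripleProd, ← hc, smul_dotProduct, dot_self_cross, smul_zero]

theorem not_fixesFrame_rootTwo {U : Fin 3 → Fin 3 → ℝ} {y : Frame} (h : FrameRep U y) :
    ¬ FixesFrame (rootTwo U) y := by
  intro hA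
  obtain ⟨c, hc⟩ := ((h 2).preservesLine_iff _).1 (hA 2)
  have hT := h.tripleProd_ne_zero
  have h1 : (U 0 ⨯₃ U 1) ⬝ᵥ U 2 = tripleProd U := by
    rw [dotProduct_comm, tripleProd, triple_product_permutation]
  rw [rootTwo, Matrix.smul_mulVec, vecMulVec_mulVec', h1, smul_smul, inv_mul_cancel₀ hT,
    one_smul] at hc
  apply hT
  rw [tripleProd, ← hc, map_smul, LinearMap.smul_apply, cross_self, smul_zero, dotProduct_zero]

theorem tripleProd_mulVec (g : SL(3, ℝ)) (U : Fin 3 → Fin 3 → ℝ) :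
    tripleProd (fun j => g.1 *ᵥ U j) = tripleProd U := by
  simp only [tripleProd]
  rw [← dual_mulVec_cross]
  change _ ⬝ᵥ ((g⁻¹).1.transpose *ᵥ _) = _
  rw [Matrix.mulVec_transpose, dotProduct_comm, ← Matrix.dotProduct_mulVec, Matrix.mulVec_mulVec,
    coe_inv_mul, Matrix.one_mulVec, dotProduct_comm]

theorem tripleProd_smul (d : Fin 3 → ℝ) (U : Fin 3 → Fin 3 → ℝ) :
    tripleProd (fun j => d j • U j) = d 0 * d 1 * d 2 * tripleProd U := by
  simp only [tripleProd, map_smul, LinearMap.smul_apply, smul_dotProduct, dotProduct_smul,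
    smul_eq_mul]
  ring

theorem conj_vecMulVec_cross (g : SL(3, ℝ)) (u v w : Fin 3 → ℝ) :
    g.1 * Matrix.vecMulVec u (v ⨯₃ w) * (g⁻¹).1 =
      Matrix.vecMulVec (g.1 *ᵥ u) ((g.1 *ᵥ v) ⨯₃ (g.1 *ᵥ w)) := by
  rw [← dual_mulVec_cross, Matrix.mul_vecMulVec, Matrix.vecMulVec_mul, ← Matrix.mulVec_transpose]
  rfl

theorem conj_rootOne {g : SL(3, ℝ)} {U U' : Fin 3 → Fin 3 → ℝ} {d : Fin 3 → ℝ}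
    (hg : ∀ j, g.1 *ᵥ U' j = d j • U j) (hd : ∀ j, d j ≠ 0) :
    g.1 * rootOne U' * (g⁻¹).1 = (d 0 / d 1) • rootOne U := by
  have hT : tripleProd U' = d 0 * d 1 * d 2 * tripleProd U := by
    rw [← tripleProd_smul, ← tripleProd_mulVec g]
    simp_rw [hg]
  have h0 := hd 0
  have h1 := hd 1
  have h2 := hd 2
  rw [rootOne, Matrix.mul_smul, Matrix.smul_mul, conj_vecMulVec_cross, hg, hg, hT, rootOne]
  simp only [map_smul, LinearMap.smul_apply, Matrix.smul_vecMulVec, Matrix.vecMulVec_smul,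
    smul_smul]
  congr 1
  field_simp

theorem conj_rootTwo {g : SL(3, ℝ)} {U U' : Fin 3 → Fin 3 → ℝ} {d : Fin 3 → ℝ}
    (hg : ∀ j, g.1 *ᵥ U' j = d j • U j) (hd : ∀ j, d j ≠ 0) :
    g.1 * rootTwo U' * (g⁻¹).1 = (d 1 / d 2) • rootTwo U := by
  have hT : tripleProd U' = d 0 * d 1 * d 2 * tripleProd U := by
    rw [← tripleProd_smul, ← tripleProd_mulVec g]
    simp_rw [hg]
  have h0 := hd 0
  have h1 := hd 1
  have h2 := hd 2
  rw [rootTwo, Matrix.mul_smul, Matrix.smul_mul, conj_vecMulVec_cross, hg, hg, hT, rootTwo]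
  simp only [map_smul, LinearMap.smul_apply, Matrix.smul_vecMulVec, Matrix.vecMulVec_smul,
    smul_smul]
  congr 1
  field_simp

theorem tendsto_vecMulVec {I : Type*} {l : Filter I} {u v : I → Fin 3 → ℝ} {u₀ v₀ : Fin 3 → ℝ}
    (hu : Tendsto u l (𝓝 u₀)) (hv : Tendsto v l (𝓝 v₀)) :
    Tendsto (fun i => Matrix.vecMulVec (u i) (v i)) l (𝓝 (Matrix.vecMulVec u₀ v₀)) := by
  have hc : Continuous fun w : (Fin 3 → ℝ) × (Fin 3 → ℝ) => Matrix.vecMulVec w.1 w.2 := by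
    fun_prop
  exact (hc.tendsto (u₀, v₀)).comp (hu.prodMk_nhds hv)

theorem tendsto_rootOne {I : Type*} {l : Filter I} {U : I → Fin 3 → Fin 3 → ℝ}
    {U₀ : Fin 3 → Fin 3 → ℝ} (hU : Tendsto U l (𝓝 U₀)) (hT : tripleProd U₀ ≠ 0) :
    Tendsto (fun i => rootOne (U i)) l (𝓝 (rootOne U₀)) := by
  have h := tendsto_tripleProd hU
  rw [tendsto_pi_nhds] at hU
  exact (h.inv₀ hT).smul (tendsto_vecMulVec (hU 0) (tendsto_cross (hU 2) (hU 0)))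

theorem tendsto_rootTwo {I : Type*} {l : Filter I} {U : I → Fin 3 → Fin 3 → ℝ}
    {U₀ : Fin 3 → Fin 3 → ℝ} (hU : Tendsto U l (𝓝 U₀)) (hT : tripleProd U₀ ≠ 0) :
    Tendsto (fun i => rootTwo (U i)) l (𝓝 (rootTwo U₀)) := by
  have h := tendsto_tripleProd hU
  rw [tendsto_pi_nhds] at hU
  exact (h.inv₀ hT).smul (tendsto_vecMulVec (hU 1) (tendsto_cross (hU 0) (hU 1)))

/-! ### Cocompactness -/

section Cocompact

theorem exists_continuous_ge (c : ℕ → ℝ) (hc : ∀ n, 0 ≤ c n) :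
    ∃ F : ℝ → ℝ, Continuous F ∧ (∀ s, 0 < F s) ∧ ∀ (n : ℕ) (s : ℝ), n ≤ s → c n ≤ F s := by
  let φ : ℕ → ℝ → ℝ := fun n s => c n * max 0 (s - n + 1)
  have hnonneg : ∀ n s, 0 ≤ φ n s := fun n s => mul_nonneg (hc n) (le_max_left _ _)
  have hlt : ∀ n s, φ n s ≠ 0 → (n : ℝ) < s + 1 := by
    intro n s h
    by_contra hcon
    apply h
    have : max 0 (s - n + 1) = 0 := max_eq_left (by linarith)
    simp [φ, this]
  have hfin : ∀ R : ℝ, {n : ℕ | (n : ℝ) < R}.Finite := fun R =>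
    (Set.finite_Iio ⌈R⌉₊).subset fun n hn => Nat.lt_ceil.2 hn
  refine ⟨fun s => 1 + ∑ᶠ n, φ n s, continuous_const.add (continuous_finsum ?_ ?_), ?_, ?_⟩
  · intro n
    fun_prop
  · intro s₀
    refine ⟨Set.Iio (s₀ + 1), Iio_mem_nhds (by linarith), (hfin (s₀ + 2)).subset ?_⟩
    rintro n ⟨s, hs, hs'⟩
    have h1 := hlt n s hs
    have h2 : s < s₀ + 1 := hs'
    change (n : ℝ) < s₀ + 2
    linarith
  · intro s
    have := finsum_nonneg fun n => hnonneg n s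
    linarith
  · intro n s hn
    have h1 : φ n s ≤ ∑ᶠ n, φ n s :=
      single_le_finsum n ((hfin (s + 1)).subset fun n h => hlt n s h) fun n => hnonneg n s
    have h2 : c n ≤ φ n s := le_mul_of_one_le_right (hc n) (le_max_of_le_right (by linarith))
    linarith

variable {Γ : Type*} [Group Γ] {ι : Γ →* SL(2, ℝ)} {ρ : Γ →* SL(3, ℝ)}

/-- If the quotient is not compact, then some orbit of the flow diverges. -/
theorem exists_divergent_ray (hι : Function.Injective ι) (hdisc : DiscreteTopology ι.range)
    (hunb : ∀ R : ℝ, ∃ h, R < orbitDist ι h) :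
    ∃ k : SL(2, ℝ), ∀ t, 0 ≤ t → Real.exp (2 * t) ≤ orbitDist ι (k * diagFlow t) := by
  choose h hh using fun n : ℕ => hunb (2 * Real.exp (2 * n))
  choose γ hγ using fun n => exists_orbitDist_eq hι hdisc (h n)
  choose k k' t hk hk' ht hkak using fun n => exists_cartan ((ι (γ n))⁻¹ * h n)
  have hdist : ∀ n, orbitDist ι (k n * diagFlow (t n)) = normSq (diagFlow (t n)) := by
    intro n
    rw [← hkak, orbitDist_mul_of_isRot _ _ (hk' n), ← map_inv, orbitDist_mul, hγ,
      ← normSq_mul_of_isRot _ (hk' n), hkak, normSq_of_isRot_mul (hk n)]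
  have hseg : ∀ n s, 0 ≤ s → s ≤ t n → ∀ α : Γ,
      Real.exp (2 * s) ≤ normSq ((ι α)⁻¹ * (k n * diagFlow s)) := by
    intro n s _ hs α
    have h1 := orbitDist_le ι (k n * diagFlow (t n)) α
    rw [hdist] at h1
    have h2 := normSq_mul_diagFlow_le ((ι α)⁻¹ * (k n * diagFlow s)) (sub_nonneg.2 hs)
    rw [mul_assoc, mul_assoc, ← diagFlow_add, add_sub_cancel] at h2
    have h3 := (exp_le_normSq_diagFlow (t n)).trans (h1.trans h2)
    have h4 : Real.exp (2 * t n) = Real.exp (2 * (t n - s)) * Real.exp (2 * s) := by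
      rw [← Real.exp_add]
      ring_nf
    rw [h4] at h3
    exact le_of_mul_le_mul_left h3 (Real.exp_pos _)
  have htn : ∀ n : ℕ, (n : ℝ) ≤ t n := by
    intro n
    have h1 : 2 * Real.exp (2 * n) < normSq (diagFlow (t n)) := by
      rw [← hdist n, ← hkak, orbitDist_mul_of_isRot _ _ (hk' n), ← map_inv, orbitDist_mul]
      exact hh n
    have h2 : normSq (diagFlow (t n)) ≤ 2 * Real.exp (2 * t n) := by
      have := normSq_mul_diagFlow_le 1 (ht n)
      rw [one_mul] at this
      refine this.trans_eq ?_
      norm_num [normSq, mul_comm]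
    have h3 : Real.exp (2 * n) < Real.exp (2 * t n) := by linarith
    have := Real.exp_lt_exp.1 h3
    linarith
  obtain ⟨k₀, -, hlim⟩ := exists_tendsto_of_mem_compact (isCompact_normSq_le 2) (hyperfilter ℕ)
    (u := k) fun n => (normSq_of_isRot (hk n)).le
  refine ⟨k₀, fun s hs => le_ciInf fun α => ?_⟩
  have hcont : Continuous fun x : SL(2, ℝ) => normSq ((ι α)⁻¹ * (x * diagFlow s)) :=
    continuous_normSq.comp ((continuous_const_mul _).comp (continuous_mul_const _))
  refine ge_of_tendsto ((hcont.tendsto k₀).comp hlim) ?_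
  have hev : ∀ᶠ n : ℕ in (hyperfilter ℕ : Filter ℕ), s ≤ n := by
    have : ∀ᶠ n : ℕ in atTop, s ≤ n := (eventually_ge_atTop ⌈s⌉₊).mono fun n hn => Nat.ceil_le.1 hn
    exact this.filter_mono hyperfilter_le_atTop
  filter_upwards [hev] with n hn
  exact hseg n s hs (hn.trans (htn n)) α

/-- The group of an Anosov structure is cocompact. -/
theorem IsAnosovStructure.exists_normSq_le (hι : Function.Injective ι)
    (hdisc : DiscreteTopology ι.range) {f : SL(2, ℝ) → Frame} (hf : IsAnosovStructure ι ρ f) :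
    ∃ R : ℝ, ∀ h : SL(2, ℝ), ∃ γ : Γ, normSq ((ι γ)⁻¹ * h) ≤ R := by
  by_contra hcon
  push Not at hcon
  obtain ⟨k, hk⟩ := exists_divergent_ray hι hdisc fun R => by
    obtain ⟨h, hh⟩ := hcon R
    obtain ⟨γ, hγ⟩ := exists_orbitDist_eq hι hdisc h
    exact ⟨h, hγ ▸ hh γ⟩
  have hrep := frameRep_rep (f k)
  let A := rootOne fun j => ((f k).1 j).rep
  let N₀ : VerticalNorm ι ρ := averagedNorm ρ hι hdisc (fun _ => 1) continuous_const
    (fun _ => one_pos) (fun _ _ => rfl)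
  have hν : ∀ h, 0 < N₀.norm h (f k) A := fun h =>
    lt_of_le_of_ne (apply_nonneg _ _)
      (fun h0 => not_fixesFrame_rootOne hrep ((N₀.norm_eq_zero_iff _ _ _).1 h0.symm))
  obtain ⟨F, hF, hFpos, hFge⟩ := exists_continuous_ge
    (fun n => (N₀.norm (k * diagFlow n) (f k) A)⁻¹) fun n => (inv_pos.2 (hν _)).le
  let N : VerticalNorm ι ρ := averagedNorm ρ hι hdisc (fun h => F (orbitDist ι h))
    (hF.comp (continuous_orbitDist hι hdisc)) (fun _ => hFpos _)
    (fun γ h => by rw [orbitDist_mul])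
  have hN : ∀ h, N.norm h (f k) A = F (orbitDist ι h) * N₀.norm h (f k) A := by
    intro h
    simp only [N, N₀, averagedNorm_apply, one_mul]
  obtain ⟨a, b, ha, hb, hyp⟩ := hf.hyperbolic N
  have hbound : ∀ n : ℕ, 0 < n → 1 ≤ b * Real.exp (-a * n) * N.norm k (f k) A := by
    intro n hn
    refine le_trans ?_ ((hyp k n (by exact_mod_cast hn) A).1 (fixesFlag_rootOne hrep))
    rw [hN]
    have h1 : (n : ℝ) ≤ orbitDist ι (k * diagFlow n) := by
      refine le_trans ?_ (hk n n.cast_nonneg)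
      have := Real.add_one_le_exp (2 * (n : ℝ))
      have hn0 : (0 : ℝ) ≤ n := n.cast_nonneg
      linarith
    have h2 := mul_le_mul_of_nonneg_right (hFge n _ h1) (hν (k * diagFlow n)).le
    rwa [inv_mul_cancel₀ (hν _).ne'] at h2
  have hlim : Tendsto (fun n : ℕ => b * Real.exp (-a * n) * N.norm k (f k) A) atTop
      (𝓝 (b * 0 * N.norm k (f k) A)) := by
    refine (Tendsto.const_mul b (Real.tendsto_exp_atBot.comp ?_)).mul_const _
    exact tendsto_natCast_atTop_atTop.const_mul_atTop_of_neg (neg_lt_zero.2 ha)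
  rw [mul_zero, zero_mul] at hlim
  have := ge_of_tendsto hlim (eventually_gt_atTop 0 |>.mono hbound)
  linarith

end Cocompact

end AnosovFlag

end

namespace AnosovFlag

/-! ### Attracting and repelling flags -/

open Filter Topology
open scoped Matrix

section Attracts

variable {I : Type*} {l : Ultrafilter I}

/-- The matrices `g i` attract points off the line of `F'` to the point of `F`, and lines off the
point of `F'` to the line of `F`, locally uniformly. -/
structure Attracts (l : Ultrafilter I) (g : I → SL(3, ℝ)) (F F' : Flag) : Prop where
  pt : ∀ (z : I → P2) (z₀ : P2), Tendsto z l (𝓝 z₀) → ¬ z₀.orthogonal F'.line →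
    Tendsto (fun i => g i • z i) l (𝓝 F.pt)
  line : ∀ (z : I → P2) (z₀ : P2), Tendsto z l (𝓝 z₀) → ¬ z₀.orthogonal F'.pt →
    Tendsto (fun i => dual (g i) • z i) l (𝓝 F.line)

theorem exists_not_orthogonal_pair (p q : P2) : ∃ z : P2, ¬ z.orthogonal p ∧ ¬ z.orthogonal q := by
  have hne : ∀ (v : Fin 3 → ℝ) (x : P2), v ⬝ᵥ x.rep ≠ 0 → v ≠ 0 := by
    rintro v x h rfl
    simp at h
  suffices ∃ v : Fin 3 → ℝ, v ⬝ᵥ p.rep ≠ 0 ∧ v ⬝ᵥ q.rep ≠ 0 by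
    obtain ⟨v, h1, h2⟩ := this
    refine ⟨Projectivization.mk ℝ v (hne v p h1), ?_, ?_⟩
    · rwa [(rep_mk _).orthogonal_iff (rep_rep p)]
    · rwa [(rep_mk _).orthogonal_iff (rep_rep q)]
  have hp : p.rep ⬝ᵥ p.rep ≠ 0 := by simpa using p.rep_nonzero
  have hq : q.rep ⬝ᵥ q.rep ≠ 0 := by simpa using q.rep_nonzero
  by_cases h : p.rep ⬝ᵥ q.rep = 0
  · refine ⟨p.rep + q.rep, ?_, ?_⟩
    · rwa [add_dotProduct, dotProduct_comm q.rep, h, add_zero]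
    · rwa [add_dotProduct, h, zero_add]
  · exact ⟨p.rep, hp, h⟩

theorem Flag.ext {F F' : Flag} (h1 : F.pt = F'.pt) (h2 : F.line = F'.line) : F = F' :=
  Subtype.ext (Prod.ext h1 h2)

/-- The attracting flag is unique. -/
theorem Attracts.unique {g : I → SL(3, ℝ)} {F₁ F₁' F₂ F₂' : Flag} (h₁ : Attracts l g F₁ F₁')
    (h₂ : Attracts l g F₂ F₂') : F₁ = F₂ := by
  obtain ⟨z, hz₁, hz₂⟩ := exists_not_orthogonal_pair F₁'.line F₂'.line
  obtain ⟨m, hm₁, hm₂⟩ := exists_not_orthogonal_pair F₁'.pt F₂'.pt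
  exact Flag.ext
    (tendsto_nhds_unique (h₁.pt _ z tendsto_const_nhds hz₁) (h₂.pt _ z tendsto_const_nhds hz₂))
    (tendsto_nhds_unique (h₁.line _ m tendsto_const_nhds hm₁)
      (h₂.line _ m tendsto_const_nhds hm₂))

theorem attracts_of_multipliers {g : I → SL(3, ℝ)} {U U' : I → Fin 3 → Fin 3 → ℝ}
    {U₀ U₀' : Fin 3 → Fin 3 → ℝ} {d : I → Fin 3 → ℝ}
    (hg : ∀ i j, (g i).1 *ᵥ U' i j = d i j • U i j) (hd : ∀ i j, d i j ≠ 0)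
    (h1 : Tendsto (fun i => d i 1 / d i 0) l (𝓝 0)) (h2 : Tendsto (fun i => d i 2 / d i 1) l (𝓝 0))
    (hU : Tendsto U l (𝓝 U₀)) (hU' : Tendsto U' l (𝓝 U₀')) (hT : ∀ i, tripleProd (U' i) ≠ 0)
    (hT₀ : tripleProd U₀' ≠ 0) {F F' : Flag} (hFp : Rep (U₀ 0) F.pt)
    (hFl : Rep (U₀ 0 ⨯₃ U₀ 1) F.line) (hFp' : Rep (U₀' 2) F'.pt)
    (hFl' : Rep (U₀' 2 ⨯₃ U₀' 1) F'.line) : Attracts l g F F' where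
  pt z z₀ hz hz₀ := by
    obtain ⟨v, v₀, hv, hv₀, hlim⟩ := exists_rep_tendsto l hz
    refine tendsto_smul_P2 hg hd h1 h2 hU hU' hT hv hlim ?_ hFp
    rw [hv₀.orthogonal_iff hFl', ← cross_anticomm, dotProduct_neg, neg_eq_zero] at hz₀
    exact hz₀
  line z z₀ hz hz₀ := by
    obtain ⟨v, v₀, hv, hv₀, hlim⟩ := exists_rep_tendsto l hz
    rw [hv₀.orthogonal_iff hFp'] at hz₀
    exact tendsto_dual_smul_P2 hg hd h1 h2 hU hU' hT hT₀ hv hlim hz₀ hFl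

end Attracts

section Anosov

variable {Γ : Type*} [Group Γ] {ι : Γ →* SL(2, ℝ)} {ρ : Γ →* SL(3, ℝ)} {f : SL(2, ℝ) → Frame}

/-- Along orbits of the flow, the tangent vectors in `E⁺` are contracted. -/
theorem IsAnosovStructure.tendsto_inv_zero (hf : IsAnosovStructure ι ρ f) (N : VerticalNorm ι ρ)
    {I : Type*} {l : Filter I} {γ : I → Γ} {c h : I → SL(2, ℝ)} {t : I → ℝ} {c₀ h₀ : SL(2, ℝ)}
    (hγ : ∀ i, ι (γ i) * c i = h i * diagFlow (t i)) (hc : Tendsto c l (𝓝 c₀))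
    (hh : Tendsto h l (𝓝 h₀)) (ht : Tendsto t l atTop) {B B' : I → Mat3} {B₀ B₀' : Mat3}
    {r : I → ℝ} (hr : ∀ i, r i ≠ 0)
    (hB : ∀ i, (ρ (γ i)).1 * B' i * ((ρ (γ i))⁻¹).1 = r i • B i)
    (hfix : ∀ i, FixesFlag (B i) (piPlus (f (h i)))) (hBlim : Tendsto B l (𝓝 B₀))
    (hBlim' : Tendsto B' l (𝓝 B₀')) (hB₀' : ¬ FixesFrame B₀' (f c₀)) :
    Tendsto (fun i => (r i)⁻¹) l (𝓝 0) := by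
  obtain ⟨a, b, ha, hb, hyp⟩ := hf.hyperbolic N
  have hlim : Tendsto (fun i => N.norm (h i) (f (h i)) (B i)) l (𝓝 (N.norm h₀ (f h₀) B₀)) :=
    (N.continuous_norm.tendsto (h₀, f h₀, B₀)).comp
      (hh.prodMk_nhds (((hf.continuous.tendsto h₀).comp hh).prodMk_nhds hBlim))
  have hlim' : Tendsto (fun i => N.norm (c i) (f (c i)) (B' i)) l (𝓝 (N.norm c₀ (f c₀) B₀')) :=
    (N.continuous_norm.tendsto (c₀, f c₀, B₀')).comp
      (hc.prodMk_nhds (((hf.continuous.tendsto c₀).comp hc).prodMk_nhds hBlim'))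
  have hpos : 0 < N.norm c₀ (f c₀) B₀' :=
    lt_of_le_of_ne (apply_nonneg _ _) fun h0 => hB₀' ((N.norm_eq_zero_iff _ _ _).1 h0.symm)
  have hexp : Tendsto (fun i => b * Real.exp (-a * t i)) l (𝓝 (b * 0)) :=
    (Real.tendsto_exp_atBot.comp (ht.const_mul_atTop_of_neg (neg_lt_zero.2 ha))).const_mul b
  have hbig := (hexp.mul hlim).div hlim' hpos.ne'
  rw [mul_zero, zero_mul, zero_div] at hbig
  refine squeeze_zero_norm' ?_ hbig
  filter_upwards [ht.eventually_gt_atTop 0, hlim'.eventually (lt_mem_nhds hpos)] with i hti hNi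
  have h1 : N.norm (c i) (f (c i)) (B' i) =
      |r i| * N.norm (h i * diagFlow (t i)) (f (h i)) (B i) := by
    rw [← N.norm_smul (γ i), hB, hγ, ← hf.equivariant, hγ, hf.flow_invariant, map_smul_eq_mul,
      Real.norm_eq_abs]
  have h2 := (hyp (h i) (t i) hti (B i)).1 (hfix i)
  have hri : 0 < |r i| := abs_pos.2 (hr i)
  rw [Real.norm_eq_abs, abs_inv, Pi.div_apply, le_div_iff₀ hNi, h1, ← mul_assoc,
    inv_mul_cancel₀ hri.ne', one_mul]
  exact h2

theorem IsAnosovStructure.exists_multipliers (hf : IsAnosovStructure ι ρ f)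
    (N : VerticalNorm ι ρ) {I : Type*} {l : Ultrafilter I} {γ : I → Γ} {c h : I → SL(2, ℝ)}
    {t : I → ℝ} {c₀ h₀ : SL(2, ℝ)} (hγ : ∀ i, ι (γ i) * c i = h i * diagFlow (t i))
    (hc : Tendsto c l (𝓝 c₀)) (hh : Tendsto h l (𝓝 h₀)) (ht : Tendsto t l atTop) :
    ∃ (U U' : I → Fin 3 → Fin 3 → ℝ) (U₀ U₀' : Fin 3 → Fin 3 → ℝ) (d : I → Fin 3 → ℝ),
      (∀ i, FrameRep (U i) (f (h i))) ∧ (∀ i, FrameRep (U' i) (f (c i))) ∧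
      FrameRep U₀ (f h₀) ∧ FrameRep U₀' (f c₀) ∧ Tendsto U l (𝓝 U₀) ∧ Tendsto U' l (𝓝 U₀') ∧
      (∀ i j, (ρ (γ i)).1 *ᵥ U' i j = d i j • U i j) ∧ (∀ i j, d i j ≠ 0) ∧
      Tendsto (fun i => d i 1 / d i 0) l (𝓝 0) ∧ Tendsto (fun i => d i 2 / d i 1) l (𝓝 0) := by
  obtain ⟨U, U₀, hU, hU₀, hUlim⟩ :=
    exists_frameRep_tendsto l ((hf.continuous.tendsto h₀).comp hh)
  obtain ⟨U', U₀', hU', hU₀', hUlim'⟩ :=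
    exists_frameRep_tendsto l ((hf.continuous.tendsto c₀).comp hc)
  have hmap : ∀ i, ρ (γ i) • f (c i) = f (h i) := fun i => by
    rw [← hf.equivariant, hγ, hf.flow_invariant]
  choose d hd hg using fun i j => (hU i j).eq_smul ((hmap i) ▸ (hU' i).mulVec (ρ (γ i)) j)
  have h1 := hf.tendsto_inv_zero N hγ hc hh ht (fun i => div_ne_zero (hd i 0) (hd i 1))
    (fun i => conj_rootOne (hg i) (hd i)) (fun i => fixesFlag_rootOne (hU i))
    (tendsto_rootOne hUlim hU₀.tripleProd_ne_zero)
    (tendsto_rootOne hUlim' hU₀'.tripleProd_ne_zero) (not_fixesFrame_rootOne hU₀')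
  have h2 := hf.tendsto_inv_zero N hγ hc hh ht (fun i => div_ne_zero (hd i 1) (hd i 2))
    (fun i => conj_rootTwo (hg i) (hd i)) (fun i => fixesFlag_rootTwo (hU i))
    (tendsto_rootTwo hUlim hU₀.tripleProd_ne_zero)
    (tendsto_rootTwo hUlim' hU₀'.tripleProd_ne_zero) (not_fixesFrame_rootTwo hU₀')
  simp only [inv_div] at h1 h2
  exact ⟨U, U', U₀, U₀', d, hU, hU', hU₀, hU₀', hUlim, hUlim', hg, hd, h1, h2⟩

theorem IsAnosovStructure.attracts_piPlus (hf : IsAnosovStructure ι ρ f)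
    (N : VerticalNorm ι ρ) {I : Type*} {l : Ultrafilter I} {γ : I → Γ} {c h : I → SL(2, ℝ)}
    {t : I → ℝ} {c₀ h₀ : SL(2, ℝ)} (hγ : ∀ i, ι (γ i) * c i = h i * diagFlow (t i))
    (hc : Tendsto c l (𝓝 c₀)) (hh : Tendsto h l (𝓝 h₀)) (ht : Tendsto t l atTop) :
    Attracts l (fun i => ρ (γ i)) (piPlus (f h₀)) (piMinus (f c₀)) := by
  obtain ⟨U, U', U₀, U₀', d, -, hU', hU₀, hU₀', hlim, hlim', hg, hd, h1, h2⟩ :=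
    hf.exists_multipliers N hγ hc hh ht
  exact attracts_of_multipliers hg hd h1 h2 hlim hlim' (fun i => (hU' i).tripleProd_ne_zero)
    hU₀'.tripleProd_ne_zero hU₀.piPlus_pt hU₀.piPlus_line hU₀'.piMinus_pt hU₀'.piMinus_line

theorem tripleProd_rev (U : Fin 3 → Fin 3 → ℝ) :
    tripleProd (fun j => U j.rev) = -tripleProd U := by
  change U 2 ⬝ᵥ (U 1 ⨯₃ U 0) = -(U 0 ⬝ᵥ (U 1 ⨯₃ U 2))
  rw [← cross_anticomm, dotProduct_neg, triple_product_permutation]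

theorem IsAnosovStructure.attracts_piMinus (hf : IsAnosovStructure ι ρ f)
    (N : VerticalNorm ι ρ) {I : Type*} {l : Ultrafilter I} {γ : I → Γ} {c h : I → SL(2, ℝ)}
    {t : I → ℝ} {c₀ h₀ : SL(2, ℝ)} (hγ : ∀ i, ι (γ i) * c i = h i * diagFlow (-t i))
    (hc : Tendsto c l (𝓝 c₀)) (hh : Tendsto h l (𝓝 h₀)) (ht : Tendsto t l atTop) :
    Attracts l (fun i => ρ (γ i)) (piMinus (f h₀)) (piPlus (f c₀)) := by
  have hγ' : ∀ i, ι (γ i)⁻¹ * h i = c i * diagFlow (t i) := fun i => by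
    rw [map_inv, inv_mul_eq_iff_eq_mul, ← mul_assoc, hγ, mul_assoc, ← diagFlow_add, neg_add_cancel,
      diagFlow_zero, mul_one]
  obtain ⟨U, U', U₀, U₀', d, hU, hU', hU₀, hU₀', hlim, hlim', hg, hd, h1, h2⟩ :=
    hf.exists_multipliers N hγ' hh hc ht
  have hrev : Continuous fun W : Fin 3 → Fin 3 → ℝ => fun j : Fin 3 => W j.rev := by fun_prop
  refine attracts_of_multipliers (U := fun i j => U' i j.rev) (U' := fun i j => U i j.rev)
    (d := fun i j => (d i j.rev)⁻¹) ?_ (fun i j => inv_ne_zero (hd i j.rev)) ?_ ?_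
    ((hrev.tendsto U₀').comp hlim') ((hrev.tendsto U₀).comp hlim) ?_ ?_
    hU₀'.piMinus_pt hU₀'.piMinus_line hU₀.piPlus_pt hU₀.piPlus_line
  · intro i j
    have h := congrArg (fun w => (ρ (γ i)).1 *ᵥ w) (hg i j.rev)
    simp only [Matrix.mulVec_mulVec, map_inv, coe_mul_inv, Matrix.one_mulVec,
      Matrix.mulVec_smul] at h
    rw [h, smul_smul, inv_mul_cancel₀ (hd i j.rev), one_smul]
  · refine h2.congr fun i => ?_
    change _ = (d i 1)⁻¹ / (d i 2)⁻¹
    rw [inv_div_inv]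
  · refine h1.congr fun i => ?_
    change _ = (d i 0)⁻¹ / (d i 1)⁻¹
    rw [inv_div_inv]
  · intro i
    rw [tripleProd_rev]
    exact neg_ne_zero.2 (hU i).tripleProd_ne_zero
  · rw [tripleProd_rev]
    exact neg_ne_zero.2 hU₀.tripleProd_ne_zero

/-! ### The limit curve -/

theorem tendsto_natCast_hyperfilter :
    Tendsto (fun n : ℕ => (n : ℝ)) (hyperfilter ℕ : Filter ℕ) atTop :=
  tendsto_natCast_atTop_atTop.mono_left hyperfilter_le_atTop

theorem IsAnosovStructure.piPlus_mul_upper (hf : IsAnosovStructure ι ρ f) (N : VerticalNorm ι ρ)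
    {R : ℝ} (hR : ∀ h : SL(2, ℝ), ∃ γ : Γ, normSq ((ι γ)⁻¹ * h) ≤ R) (h : SL(2, ℝ))
    {b : SL(2, ℝ)} (hb : b.1 1 0 = 0) : piPlus (f (h * b)) = piPlus (f h) := by
  choose γ hγ using fun n : ℕ => hR (h * diagFlow n)
  obtain ⟨c₀, -, hc₀⟩ := exists_tendsto_of_mem_compact (isCompact_normSq_le R) (hyperfilter ℕ) hγ
  obtain ⟨b₀, hb₀⟩ := tendsto_diagFlow_conj hb
  have h1 := hf.attracts_piPlus N (γ := γ) (h := fun _ => h) (fun n => mul_inv_cancel_left _ _) hc₀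
    tendsto_const_nhds tendsto_natCast_hyperfilter
  have h2 := hf.attracts_piPlus N (γ := γ) (h := fun _ => h * b) (t := fun n : ℕ => (n : ℝ))
    (c := fun n : ℕ => (ι (γ n))⁻¹ * (h * diagFlow n) * (diagFlow (-(n : ℝ)) * b * diagFlow n))
    (fun n => by
      have : diagFlow (n : ℝ) * diagFlow (-(n : ℝ)) = 1 := by
        rw [← diagFlow_add, add_neg_cancel, diagFlow_zero]
      calc ι (γ n) * ((ι (γ n))⁻¹ * (h * diagFlow n) * (diagFlow (-(n : ℝ)) * b * diagFlow n))
          = h * (diagFlow (n : ℝ) * diagFlow (-(n : ℝ))) * b * diagFlow n := by group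
        _ = h * b * diagFlow n := by rw [this, mul_one])
    (hc₀.mul (hb₀.mono_left hyperfilter_le_atTop)) tendsto_const_nhds tendsto_natCast_hyperfilter
  exact h2.unique h1

theorem IsAnosovStructure.piPlus_mul_weyl (hf : IsAnosovStructure ι ρ f) (N : VerticalNorm ι ρ)
    {R : ℝ} (hR : ∀ h : SL(2, ℝ), ∃ γ : Γ, normSq ((ι γ)⁻¹ * h) ≤ R) (h : SL(2, ℝ)) :
    piPlus (f (h * weyl)) = piMinus (f h) := by
  choose γ hγ using fun n : ℕ => hR (h * diagFlow (-(n : ℝ)))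
  obtain ⟨c₀, -, hc₀⟩ := exists_tendsto_of_mem_compact (isCompact_normSq_le R) (hyperfilter ℕ) hγ
  have h1 := hf.attracts_piMinus N (γ := γ) (h := fun _ => h) (fun n => mul_inv_cancel_left _ _)
    hc₀ tendsto_const_nhds tendsto_natCast_hyperfilter
  have h2 := hf.attracts_piPlus N (γ := γ) (h := fun _ => h * weyl) (t := fun n : ℕ => (n : ℝ))
    (c := fun n : ℕ => (ι (γ n))⁻¹ * (h * diagFlow (-(n : ℝ))) * weyl)
    (fun n => by
      have := diagFlow_mul_weyl (-(n : ℝ))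
      rw [neg_neg] at this
      rw [mul_assoc h, ← this]
      group)
    (hc₀.mul_const weyl) tendsto_const_nhds tendsto_natCast_hyperfilter
  exact h2.unique h1

theorem IsAnosovStructure.limitCurve_eq (hf : IsAnosovStructure ι ρ f) (N : VerticalNorm ι ρ)
    {R : ℝ} (hR : ∀ h : SL(2, ℝ), ∃ γ : Γ, normSq ((ι γ)⁻¹ * h) ≤ R) :
    limitCurve f = (fun h => piPlus (f h)) '' {h | normSq h ≤ 2} := by
  apply Set.Subset.antisymm
  · rintro _ ⟨h, rfl⟩
    obtain ⟨k, b, hk, hb, rfl⟩ := exists_isRot_mul_upper h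
    exact ⟨k, (normSq_of_isRot hk).le, (hf.piPlus_mul_upper N hR k hb).symm⟩
  · rintro _ ⟨h, -, rfl⟩
    exact ⟨h, rfl⟩

theorem IsAnosovStructure.isClosed_curveL (hf : IsAnosovStructure ι ρ f) (N : VerticalNorm ι ρ)
    {R : ℝ} (hR : ∀ h : SL(2, ℝ), ∃ γ : Γ, normSq ((ι γ)⁻¹ * h) ≤ R) : IsClosed (curveL f) := by
  rw [curveL, hf.limitCurve_eq N hR, Set.image_image]
  exact ((isCompact_normSq_le 2).image (continuous_pt_piPlus.comp hf.continuous)).isClosed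

theorem IsAnosovStructure.isClosed_curveLDual (hf : IsAnosovStructure ι ρ f)
    (N : VerticalNorm ι ρ) {R : ℝ} (hR : ∀ h : SL(2, ℝ), ∃ γ : Γ, normSq ((ι γ)⁻¹ * h) ≤ R) :
    IsClosed (curveLDual f) := by
  rw [curveLDual, hf.limitCurve_eq N hR, Set.image_image]
  exact ((isCompact_normSq_le 2).image (continuous_line_piPlus.comp hf.continuous)).isClosed

theorem continuous_flag_pt : Continuous Flag.pt := continuous_fst.comp continuous_subtype_val

theorem continuous_flag_line : Continuous Flag.line := continuous_snd.comp continuous_subtype_val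

/-! ### The action on the domain -/

theorem piPlus_smul (g : SL(3, ℝ)) (y : Frame) : piPlus (g • y) = g • piPlus y := by
  have hy := frameRep_rep y
  have hgy := hy.mulVec g
  refine Flag.ext rfl (Rep.unique hgy.piPlus_line ?_)
  rw [← dual_mulVec_cross]
  exact hy.piPlus_line.mulVec (dual g)

theorem IsAnosovStructure.smul_mem_limitCurve (hf : IsAnosovStructure ι ρ f) (γ : Γ) {F : Flag}
    (hF : F ∈ limitCurve f) : ρ γ • F ∈ limitCurve f := by
  obtain ⟨h, rfl⟩ := hF
  refine ⟨ι γ * h, ?_⟩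
  change piPlus (f (ι γ * h)) = _
  rw [hf.equivariant, piPlus_smul]

theorem Flag.smul_pt (g : SL(3, ℝ)) (F : Flag) : (g • F).pt = g • F.pt := rfl

theorem Flag.smul_line (g : SL(3, ℝ)) (F : Flag) : (g • F).line = dual g • F.line := rfl

theorem IsAnosovStructure.smul_mem_domainOmega (hf : IsAnosovStructure ι ρ f) (γ : Γ) {x : Flag}
    (hx : x ∈ domainOmega f) : ρ γ • x ∈ domainOmega f := by
  constructor
  · rintro ⟨F, hF, h⟩
    refine hx.1 ⟨_, hf.smul_mem_limitCurve γ⁻¹ hF, ?_⟩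
    rw [Flag.smul_pt, h, ← Flag.smul_pt, map_inv, inv_smul_smul]
  · rintro ⟨F, hF, h⟩
    refine hx.2 ⟨_, hf.smul_mem_limitCurve γ⁻¹ hF, ?_⟩
    rw [Flag.smul_line, h, ← Flag.smul_line, map_inv, inv_smul_smul]

/-- Two flags such that the point of each lies on the line of the other share their point or their
line. -/
theorem Flag.pt_eq_or_line_eq {F F' : Flag} (h1 : F.pt.orthogonal F'.line)
    (h2 : F.line.orthogonal F'.pt) : F.pt = F'.pt ∨ F.line = F'.line := by
  by_contra! hne
  have hF : F.pt.orthogonal F.line := F.2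
  have hF' : F'.pt.orthogonal F'.line := F'.2
  have r1 := rep_rep F.pt
  have r2 := rep_rep F.line
  have r3 := rep_rep F'.pt
  have r4 := rep_rep F'.line
  rw [r1.orthogonal_iff r2] at hF
  rw [r3.orthogonal_iff r4] at hF'
  rw [r1.orthogonal_iff r4] at h1
  rw [r2.orthogonal_iff r3] at h2
  have hc := r1.cross r3 hne.1
  have e1 : (F.pt.rep ⨯₃ F'.pt.rep) ⨯₃ F.line.rep = 0 := by
    rw [cross_cross_eq_smul_sub_smul, hF, dotProduct_comm F'.pt.rep, h2]
    simp
  have e2 : (F.pt.rep ⨯₃ F'.pt.rep) ⨯₃ F'.line.rep = 0 := by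
    rw [cross_cross_eq_smul_sub_smul, h1, hF']
    simp
  obtain ⟨hn, hc'⟩ := hc
  obtain ⟨n2, q2⟩ := r2
  obtain ⟨n4, q4⟩ := r4
  rw [← Projectivization.mk_eq_mk_iff_crossProduct_eq_zero hn n2, q2] at e1
  rw [← Projectivization.mk_eq_mk_iff_crossProduct_eq_zero hn n4, q4] at e2
  exact hne.2 (e1.symm.trans e2)

theorem IsAnosovStructure.properlyDiscontinuous (hf : IsAnosovStructure ι ρ f)
    (N : VerticalNorm ι ρ) (hι : Function.Injective ι) (hdisc : DiscreteTopology ι.range)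
    {R : ℝ} (hR : ∀ h : SL(2, ℝ), ∃ γ : Γ, normSq ((ι γ)⁻¹ * h) ≤ R) {K K' : Set Flag}
    (hK : IsCompact K) (hK' : IsCompact K') (hKΩ : K ⊆ domainOmega f) (hKΩ' : K' ⊆ domainOmega f) :
    {γ : Γ | (((fun x => ρ γ • x) '' K) ∩ K').Nonempty}.Finite := by
  by_contra hinf
  set S := {γ : Γ | (((fun x => ρ γ • x) '' K) ∩ K').Nonempty} with hS
  have : Infinite S := Set.infinite_coe_iff.2 hinf
  have hx : ∀ γ : S, ∃ x ∈ K, ρ γ.1 • x ∈ K' := by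
    rintro ⟨γ, _, ⟨x, hx, rfl⟩, hx'⟩
    exact ⟨x, hx, hx'⟩
  choose x hxK hxK' using hx
  choose k k' t hk hk' ht hkak using fun γ : S => exists_cartan (ι γ.1)
  let l := hyperfilter S
  obtain ⟨x₀, hx₀, hxlim⟩ := exists_tendsto_of_mem_compact hK l hxK
  obtain ⟨x₁, hx₁, hxlim'⟩ := exists_tendsto_of_mem_compact hK' l hxK'
  obtain ⟨k₀, -, hklim⟩ := exists_tendsto_of_mem_compact (isCompact_normSq_le 2) l (u := k)
    fun γ => (normSq_of_isRot (hk γ)).le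
  obtain ⟨k₀', -, hklim'⟩ := exists_tendsto_of_mem_compact (isCompact_normSq_le 2) l (u := k')
    fun γ => (normSq_of_isRot (hk' γ)).le
  have htlim : Tendsto t l atTop := by
    refine tendsto_atTop.2 fun M => ?_
    have hfin : {γ : S | ¬ M ≤ t γ}.Finite := by
      have h1 := finite_mem_compact hι hdisc (isCompact_normSq_le (2 * Real.exp (2 * M)))
      refine Set.Finite.subset (h1.preimage Subtype.val_injective.injOn) fun γ hγ => ?_
      have hγ' : t γ < M := not_le.1 hγ
      change normSq (ι γ.1) ≤ _
      rw [← normSq_mul_of_isRot _ (hk' γ), hkak, normSq_of_isRot_mul (hk γ)]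
      have h2 := normSq_mul_diagFlow_le 1 (ht γ)
      rw [one_mul] at h2
      have h3 : normSq 1 = 2 := by norm_num [normSq]
      rw [h3] at h2
      have h4 : Real.exp (2 * t γ) ≤ Real.exp (2 * M) := Real.exp_le_exp.2 (by linarith)
      linarith
    exact (eventually_cofinite.2 hfin).filter_mono hyperfilter_le_cofinite
  have hatt := hf.attracts_piPlus N (l := l) (γ := fun γ : S => γ.1) hkak hklim' hklim htlim
  have hplus : piPlus (f k₀) ∈ limitCurve f := ⟨k₀, rfl⟩
  have hminus : piMinus (f k₀') ∈ limitCurve f := ⟨k₀' * weyl, hf.piPlus_mul_weyl N hR k₀'⟩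
  have hptlim := (continuous_flag_pt.tendsto x₀).comp hxlim
  have hlinelim := (continuous_flag_line.tendsto x₀).comp hxlim
  by_cases h1 : x₀.pt.orthogonal (piMinus (f k₀')).line
  · by_cases h2 : x₀.line.orthogonal (piMinus (f k₀')).pt
    · rcases Flag.pt_eq_or_line_eq h1 h2 with h | h
      · exact (hKΩ hx₀).1 ⟨_, hminus, h.symm⟩
      · exact (hKΩ hx₀).2 ⟨_, hminus, h.symm⟩
    · have h3 := tendsto_nhds_unique (hatt.line _ _ hlinelim h2)
        ((continuous_flag_line.tendsto x₁).comp hxlim')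
      exact (hKΩ' hx₁).2 ⟨_, hplus, h3⟩
  · have h3 := tendsto_nhds_unique (hatt.pt _ _ hptlim h1)
      ((continuous_flag_pt.tendsto x₁).comp hxlim')
    exact (hKΩ' hx₁).1 ⟨_, hplus, h3⟩

end Anosov

end AnosovFlag

open scoped MatrixGroups in
open AnosovFlag in
theorem mainTheorem1 {Γ : Type*} [Group Γ] (hΓ : IsHyperbolicSurfaceGroup Γ)
    (ι : Γ →* SL(2, ℝ)) (hι : Function.Injective ι) (hdisc : DiscreteTopology ι.range)
    (ρ : Γ →* SL(3, ℝ)) (f : SL(2, ℝ) → Frame) (hf : IsAnosovStructure ι ρ f) :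
    -- `Ω` is open and `ρ(Γ)`-invariant
    IsOpen (domainOmega f) ∧
    (∀ γ : Γ, ∀ x ∈ domainOmega f, ρ γ • x ∈ domainOmega f) ∧
    -- the action is free
    (∀ γ : Γ, ∀ x ∈ domainOmega f, ρ γ • x = x → γ = 1) ∧
    -- the action is properly discontinuous
    (∀ K K' : Set Flag, IsCompact K → IsCompact K' → K ⊆ domainOmega f → K' ⊆ domainOmega f →
      {γ : Γ | (((fun x => ρ γ • x) '' K) ∩ K').Nonempty}.Finite) := by
  let N : VerticalNorm ι ρ := averagedNorm ρ hι hdisc (fun _ => 1) continuous_const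
    (fun _ => one_pos) (fun _ _ => rfl)
  obtain ⟨R, hR⟩ := hf.exists_normSq_le hι hdisc
  have hpd := fun K K' (hK : IsCompact K) (hK' : IsCompact K') (hKΩ : K ⊆ domainOmega f)
    (hKΩ' : K' ⊆ domainOmega f) => hf.properlyDiscontinuous N hι hdisc hR hK hK' hKΩ hKΩ'
  refine ⟨?_, fun γ x hx => hf.smul_mem_domainOmega γ hx, fun γ x hx hfix => ?_, hpd⟩
  · exact ((hf.isClosed_curveL N hR).isOpen_compl.preimage continuous_flag_pt).inter
      ((hf.isClosed_curveLDual N hR).isOpen_compl.preimage continuous_flag_line)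
  · have hfin := hpd {x} {x} isCompact_singleton isCompact_singleton (by simpa using hx)
      (by simpa using hx)
    have hpow : ∀ n : ℕ, ρ (γ ^ n) • x = x := by
      intro n
      induction n with
      | zero => simp
      | succ n ih => rw [pow_succ, map_mul, mul_smul, hfix, ih]
    have hmem : ∀ n : ℕ, γ ^ n ∈
        {γ : Γ | (((fun x => ρ γ • x) '' {x}) ∩ {x}).Nonempty} := fun n =>
      ⟨x, ⟨x, rfl, hpow n⟩, rfl⟩
    obtain ⟨m, -, n, -, hmn, heq⟩ := Set.infinite_univ.exists_ne_map_eq_of_mapsTo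
      (f := fun n : ℕ => γ ^ n) (fun n _ => hmem n) hfin
    wlog hlt : m < n generalizing m n
    · exact this n m hmn.symm heq.symm (lt_of_le_of_ne (not_lt.1 hlt) hmn.symm)
    refine hΓ.eq_one_of_pow_eq_one γ (k := n - m) (by omega) ?_
    have h1 : γ ^ m * γ ^ (n - m) = γ ^ m * 1 := by
      rw [← pow_add, Nat.add_sub_cancel' hlt.le, mul_one]
      exact heq.symm
    exact mul_left_cancel h1
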